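/- Let $G=(V,E)$ be a finite simple graph (in practice a planar one: each of the drawings below exists only if $G$ is planar, so planarity need not be assumed separately) and let $h\ge 0$ be an integer. Then $G$ has a planar straight-line drawing of height $h$ if and only if it has a flat visibility representation of height $h$. Here the terms mean the following. A drawing represents every vertex by a point or a box, and every edge by a curve that joins its two ends. It is planar if the representations of distinct vertices are disjoint, the curve of an edge meets the representation of no vertex other than its two ends, and the curves of two distinct edges meet only inside the representation of a common end. - In a straight-line drawing every vertex $v$ is a point of $\mathbb Z^2$, and every edge $uv$ is the straight-line segment between the points of $u$ and $v$. - In a flat visibility representation every vertex $v$ is a horizontal segment $[\ell(v),r(v)]\times\{y(v)\}$ with $\ell(v)\le r(v)$ (possibly a single point) and $\ell(v),r(v),y(v)\in\mathbb Z$. Every edge $uv$ is a horizontal or vertical segment between a point of $\mathbb Z^2$ on the segment of $u$ and a point of $\mathbb Z^2$ on the segment of $v$ (its attachment points), and meets these two vertex segments only at its attachment points. The representation is required to be planar. The defining points of a straight-line drawing are the points of its vertices; those of a flat visibility representation are the ends of its vertex segments and the attachment points of its edges. A drawing has height $h$ if, for some $w\in\mathbb N$ and after a suitable integral translation, all its defining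 points lie in $\{1,\dots,w\}\times\{1,\dots,h\}$. The equivalence also holds if "of height $h$" is read as "of height exactly $h$", meaning that $h$ is the least number for which the drawing has height $h$ in the above sense. -/

import Mathlib

namespace GraphDrawing

/-- A grid point, viewed as a point of the plane. -/
def toPlane (p : ℤ × ℤ) : ℝ × ℝ := ((p.1 : ℝ), (p.2 : ℝ))

/-- The straight-line segment between two grid points, both ends included. -/
def gridSegment (p q : ℤ × ℤ) : Set (ℝ × ℝ) := segment ℝ (toPlane p) (toPlane q)

/-- The horizontal segment from `(l, y)` to `(r, y)`, that is, a box of height zero.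
It is a single point when `l = r`. -/
def flatBox (l r y : ℤ) : Set (ℝ × ℝ) := Set.Icc (l : ℝ) (r : ℝ) ×ˢ {(y : ℝ)}

/-- Planarity of a drawing of `G` in which the vertex `v` is represented by the set `shape v` and
the edge `uv` by the set `curve u v`: no two elements of the drawing intersect, unless the
corresponding elements of the graph do.
* The shapes of distinct vertices are disjoint.
* The curve of an edge meets the shapes of its own ends only.
* The curves of two distinct edges meet only inside the shape of a common end. -/
structure IsPlanarPicture {V : Type*} (G : SimpleGraph V)
    (shape : V → Set (ℝ × ℝ)) (curve : V → V → Set (ℝ × ℝ)) : Prop where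
  vertex_vertex : ∀ u v : V, u ≠ v → Disjoint (shape u) (shape v)
  edge_vertex : ∀ u v w : V, G.Adj u v → w ≠ u → w ≠ v → Disjoint (curve u v) (shape w)
  edge_edge : ∀ u v u' v' : V, G.Adj u v → G.Adj u' v' → s(u, v) ≠ s(u', v') →
    ∀ p ∈ curve u v ∩ curve u' v', ∃ w : V, w ∈ s(u, v) ∧ w ∈ s(u', v') ∧ p ∈ shape w

/-- After a translation, all points of `P` lie on the `[1,w] × [1,h]`-grid, for some width `w`. -/
def FitsHeight (P : Set (ℤ × ℤ)) (h : ℕ) : Prop :=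
  ∃ (w : ℕ) (t : ℤ × ℤ), ∀ p ∈ P,
    p + t ∈ Set.Icc (1 : ℤ) (w : ℤ) ×ˢ Set.Icc (1 : ℤ) (h : ℤ)

/-- `h` is the least number of consecutive rows into which `P` fits. -/
def IsExactHeight (P : Set (ℤ × ℤ)) (h : ℕ) : Prop :=
  IsLeast {k : ℕ | FitsHeight P k} h

/-- A straight-line drawing of `G` with vertices at grid points: the edge `uv` is drawn as the
segment between the points of `u` and `v`. -/
structure StraightLineDrawing {V : Type*} (G : SimpleGraph V) where
  pos : V → ℤ × ℤ

namespace StraightLineDrawing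

variable {V : Type*} {G : SimpleGraph V}

def IsPlanar (D : StraightLineDrawing G) : Prop :=
  IsPlanarPicture G (fun v => {toPlane (D.pos v)}) (fun u v => gridSegment (D.pos u) (D.pos v))

/-- The defining points of the drawing: the points of the vertices. -/
def points (D : StraightLineDrawing G) : Set (ℤ × ℤ) := Set.range D.pos

end StraightLineDrawing

/-- A flat visibility representation of `G`. The vertex `v` is drawn as the horizontal segment
from `(left v, row v)` to `(right v, row v)`. The edge `uv` is drawn as the horizontal or vertical
segment between its attachment points `attach u v` on the segment of `u` and `attach v u` on the
segment of `v`; it has no other point in common with these two segments. (`attach u v` is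
meaningless when `u` and `v` are not adjacent, and is not used then.) -/
structure FlatVisibilityRepresentation {V : Type*} (G : SimpleGraph V) where
  left : V → ℤ
  right : V → ℤ
  row : V → ℤ
  attach : V → V → ℤ × ℤ
  left_le_right : ∀ v : V, left v ≤ right v
  axis_parallel : ∀ u v : V, G.Adj u v →
    (attach u v).1 = (attach v u).1 ∨ (attach u v).2 = (attach v u).2
  attached : ∀ u v : V, G.Adj u v →
    gridSegment (attach u v) (attach v u) ∩ flatBox (left u) (right u) (row u)
      = {toPlane (attach u v)}

namespace FlatVisibilityRepresentation

variable {V : Type*} {G : SimpleGraph V}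

def IsPlanar (D : FlatVisibilityRepresentation G) : Prop :=
  IsPlanarPicture G (fun v => flatBox (D.left v) (D.right v) (D.row v))
    (fun u v => gridSegment (D.attach u v) (D.attach v u))

/-- The defining points of the representation: the ends of the vertex segments and the points
where the edges are attached to them. -/
def points (D : FlatVisibilityRepresentation G) : Set (ℤ × ℤ) :=
  {p | ∃ v : V, p = (D.left v, D.row v) ∨ p = (D.right v, D.row v)} ∪
    {p | ∃ u v : V, G.Adj u v ∧ p = D.attach u v}

end FlatVisibilityRepresentation

end GraphDrawing

/-! Both directions keep every vertex in its row. The width is free and the defining points are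
finitely many, so heights depend only on the set of occupied rows (`fitsHeight_congr`,
`isExactHeight_congr`). Only horizontal coordinates have to be found.

From points to segments: call vertices and non-horizontal edges objects, and order two objects by
their abscissas at a common height. Planarity makes this relation asymmetric (`leftOf_asymm`). It
need not be transitive, but it is so whenever the middle object has the lowest upper end
(`leftOf_trans`). That is enough for an integer ranking (`exists_ranking`). A slanted edge becomes
vertical in the column given by its rank, a vertex is stretched over the columns of all objects
containing it, and a horizontal edge bridges the gap between its ends.

From segments to points: abscissas come from a harmonic function, as in a Tutte embedding. On a
refined grid, each point of a vertex segment takes the average of values seen just above and just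
below the whole segment, so the function is constant on segments. A point on a vertical edge
averages its two vertical neighbours, so the function is affine along the edge, which therefore
becomes straight. A monotone solution exists as a least fixed point (`exists_harmonic`). It is
strictly monotone across distinct intervals, because a widest tie would spread along two parallel
vertical edges joining the same two vertices, and the graph is simple (`strict_of_harmonic`,
`noparallel`). Hence the left-to-right order in every row survives straightening. This order is an
open condition that is invariant under positive scaling, so the abscissas can be made integral
(`exists_int_faithful`), and it implies planarity (`isPlanar_straighten`). -/

namespace GraphDrawing

/-! ### Lines, grid segments, planarity of oriented edges, and heights -/

/-- The abscissa at height `y` of the line through the points `(x u, r u)` and `(x v, r v)`. -/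
noncomputable def crossing {V : Type*} (x : V → ℝ) (r : V → ℤ) (u v : V) (y : ℝ) : ℝ :=
  x u + (x v - x u) * ((y - r u) / (r v - r u))

section Crossing

variable {V : Type*} (x : V → ℝ) (r : V → ℤ)

theorem crossing_self (u : V) (y : ℝ) : crossing x r u u y = x u := by
  simp [crossing]

theorem crossing_left (u v : V) : crossing x r u v (r u) = x u := by
  simp [crossing]

theorem crossing_right {u v : V} (h : r u < r v) : crossing x r u v (r v) = x v := by
  have : (r v : ℝ) - r u ≠ 0 := by
    have : (r u : ℝ) < r v := by exact_mod_cast h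
    linarith
  simp [crossing, div_self this]

theorem crossing_affine (u v : V) : ∃ α β : ℝ, ∀ y, crossing x r u v y = α + β * y :=
  ⟨x u - (x v - x u) * (r u / (r v - r u)), (x v - x u) / (r v - r u), fun y => by
    simp only [crossing, sub_div]; ring⟩

theorem crossing_const_mul (c : ℝ) (u v : V) (y : ℝ) :
    crossing (fun w => c * x w) r u v y = c * crossing x r u v y := by
  simp only [crossing]; ring

end Crossing

theorem toPlane_fst (p : ℤ × ℤ) : (toPlane p).1 = p.1 := rfl

theorem gridSegment_comm (p q : ℤ × ℤ) : gridSegment p q = gridSegment q p :=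
  segment_symm _ _ _

theorem mem_gridSegment_of_lt {p q : ℤ × ℤ} (h : p.2 < q.2) (z : ℝ × ℝ) :
    z ∈ gridSegment p q ↔ (p.2 : ℝ) ≤ z.2 ∧ z.2 ≤ q.2 ∧
      z.1 = p.1 + (q.1 - p.1) * ((z.2 - p.2) / (q.2 - p.2)) := by
  have h' : (0 : ℝ) < q.2 - p.2 := by
    have : (p.2 : ℝ) < q.2 := by exact_mod_cast h
    linarith
  constructor
  · rintro ⟨a, b, ha, hb, hab, rfl⟩
    obtain rfl : a = 1 - b := by linarith
    have e : ((1 - b) * (p.2 : ℝ) + b * q.2 - p.2) / (q.2 - p.2) = b := by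
      rw [div_eq_iff h'.ne']; ring
    simp only [toPlane, Prod.smul_mk, smul_eq_mul, Prod.mk_add_mk]
    refine ⟨by nlinarith, by nlinarith, ?_⟩
    rw [e]; ring
  · rintro ⟨h1, h2, h3⟩
    refine ⟨1 - (z.2 - p.2) / (q.2 - p.2), (z.2 - p.2) / (q.2 - p.2), ?_, ?_, by ring, ?_⟩
    · rw [sub_nonneg, div_le_one h']; linarith
    · exact div_nonneg (by linarith) h'.le
    · ext
      · simp only [toPlane, Prod.smul_mk, smul_eq_mul, Prod.mk_add_mk]
        rw [h3]; ring
      · simp only [toPlane, Prod.smul_mk, smul_eq_mul, Prod.mk_add_mk]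
        field_simp
        ring

theorem mem_gridSegment_vertical {p q : ℤ × ℤ} (h : p.2 < q.2) (h1 : p.1 = q.1) (z : ℝ × ℝ) :
    z ∈ gridSegment p q ↔ (p.2 : ℝ) ≤ z.2 ∧ z.2 ≤ q.2 ∧ z.1 = p.1 := by
  rw [mem_gridSegment_of_lt h, h1]; simp

theorem mem_gridSegment_horizontal {p q : ℤ × ℤ} (h : p.2 = q.2) (h1 : p.1 ≤ q.1) (z : ℝ × ℝ) :
    z ∈ gridSegment p q ↔ z.2 = p.2 ∧ (p.1 : ℝ) ≤ z.1 ∧ z.1 ≤ q.1 := by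
  have h1' : (p.1 : ℝ) ≤ q.1 := by exact_mod_cast h1
  constructor
  · rintro ⟨a, b, ha, hb, hab, rfl⟩
    obtain rfl : a = 1 - b := by linarith
    simp only [toPlane, Prod.smul_mk, smul_eq_mul, Prod.mk_add_mk, h]
    exact ⟨by ring, by nlinarith, by nlinarith⟩
  · rintro ⟨h2, h3, h4⟩
    rcases h1'.eq_or_lt with e | hlt
    · have : z = toPlane p := by
        ext
        · exact le_antisymm (by rw [toPlane_fst, e]; exact h4) h3
        · exact h2
      rw [this]; exact left_mem_segment _ _ _
    · have h' : (0 : ℝ) < q.1 - p.1 := by linarith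
      refine ⟨1 - (z.1 - p.1) / (q.1 - p.1), (z.1 - p.1) / (q.1 - p.1), ?_, ?_, by ring, ?_⟩
      · rw [sub_nonneg, div_le_one h']; linarith
      · exact div_nonneg (by linarith) h'.le
      · ext
        · simp only [toPlane, Prod.smul_mk, smul_eq_mul, Prod.mk_add_mk]
          field_simp
          ring
        · simp only [toPlane, Prod.smul_mk, smul_eq_mul, Prod.mk_add_mk]
          rw [h2, h]; ring

theorem mem_flatBox {l r y : ℤ} {z : ℝ × ℝ} :
    z ∈ flatBox l r y ↔ z.2 = y ∧ (l : ℝ) ≤ z.1 ∧ z.1 ≤ r := by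
  simp only [flatBox, Set.mem_prod, Set.mem_Icc, Set.mem_singleton_iff]
  tauto

theorem mk_mem_flatBox {l r y a b : ℤ} :
    ((a : ℝ), (b : ℝ)) ∈ flatBox l r y ↔ b = y ∧ l ≤ a ∧ a ≤ r := by
  rw [mem_flatBox]; dsimp only; norm_cast

/-- Planarity may be checked on edges oriented upwards (`S`) or to the right (`H`). -/
theorem IsPlanarPicture.of_oriented {V : Type*} {G : SimpleGraph V}
    {shape : V → Set (ℝ × ℝ)} {curve : V → V → Set (ℝ × ℝ)} (S H : V → V → Prop)
    (symm : ∀ u v, curve u v = curve v u)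
    (orient : ∀ u v, G.Adj u v → (S u v ∨ S v u) ∨ (H u v ∨ H v u))
    (vertex_vertex : ∀ u v, u ≠ v → Disjoint (shape u) (shape v))
    (slanted_vertex : ∀ u v w, G.Adj u v → S u v → ∀ p ∈ curve u v, p ∈ shape w → w ∈ s(u, v))
    (flat_vertex : ∀ u v w, G.Adj u v → H u v → ∀ p ∈ curve u v, p ∈ shape w → w ∈ s(u, v))
    (slanted_slanted : ∀ u v u' v', G.Adj u v → G.Adj u' v' → S u v → S u' v' →
      s(u, v) ≠ s(u', v') → ∀ p ∈ curve u v, p ∈ curve u' v' →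
        ∃ w, w ∈ s(u, v) ∧ w ∈ s(u', v') ∧ p ∈ shape w)
    (slanted_flat : ∀ u v u' v', G.Adj u v → G.Adj u' v' → S u v → H u' v' →
      ∀ p ∈ curve u v, p ∈ curve u' v' → ∃ w, w ∈ s(u, v) ∧ w ∈ s(u', v') ∧ p ∈ shape w)
    (flat_flat : ∀ u v u' v', G.Adj u v → G.Adj u' v' → H u v → H u' v' →
      s(u, v) ≠ s(u', v') → ∀ p ∈ curve u v, p ∈ curve u' v' →
        ∃ w, w ∈ s(u, v) ∧ w ∈ s(u', v') ∧ p ∈ shape w) :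
    IsPlanarPicture G shape curve := by
  have norm : ∀ u v, G.Adj u v → ∃ u' v', G.Adj u' v' ∧ s(u, v) = s(u', v') ∧
      curve u v = curve u' v' ∧ (S u' v' ∨ H u' v') := by
    intro u v h
    rcases orient u v h with (h1 | h1) | h1 | h1
    · exact ⟨u, v, h, rfl, rfl, .inl h1⟩
    · exact ⟨v, u, h.symm, Sym2.eq_swap, symm _ _, .inl h1⟩
    · exact ⟨u, v, h, rfl, rfl, .inr h1⟩
    · exact ⟨v, u, h.symm, Sym2.eq_swap, symm _ _, .inr h1⟩
  refine ⟨vertex_vertex, ?_, ?_⟩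
  · intro u v w h hu hv
    obtain ⟨u', v', h', hs, hc, ho⟩ := norm u v h
    rw [Set.disjoint_left, hc]
    intro p hp hw
    have : w ∈ s(u, v) := by
      rw [hs]
      exact ho.elim (fun ho => slanted_vertex _ _ _ h' ho p hp hw)
        fun ho => flat_vertex _ _ _ h' ho p hp hw
    simp_all
  · rintro u v u' v' h h' hne p ⟨hp, hp'⟩
    obtain ⟨a, b, hab, hs, hc, ho⟩ := norm u v h
    obtain ⟨a', b', hab', hs', hc', ho'⟩ := norm u' v' h'
    rw [hs, hs'] at hne ⊢
    rw [hc] at hp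
    rw [hc'] at hp'
    rcases ho with ho | ho <;> rcases ho' with ho' | ho'
    · exact slanted_slanted _ _ _ _ hab hab' ho ho' hne p hp hp'
    · exact slanted_flat _ _ _ _ hab hab' ho ho' p hp hp'
    · obtain ⟨w, h1, h2, h3⟩ := slanted_flat _ _ _ _ hab' hab ho' ho p hp' hp
      exact ⟨w, h2, h1, h3⟩
    · exact flat_flat _ _ _ _ hab hab' ho ho' hne p hp hp'

/-- The horizontal constraint is vacuous for a finite set, since `w` may be taken as large as
needed. -/
theorem fitsHeight_iff {P : Set (ℤ × ℤ)} (hP : P.Finite) (k : ℕ) :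
    FitsHeight P k ↔ ∃ t : ℤ, ∀ y ∈ Prod.snd '' P, 1 ≤ y + t ∧ y + t ≤ k := by
  constructor
  · rintro ⟨w, t, h⟩
    refine ⟨t.2, ?_⟩
    rintro _ ⟨p, hp, rfl⟩
    exact (h p hp).2
  · rintro ⟨t, h⟩
    obtain ⟨a, ha⟩ := (hP.image Prod.fst).bddBelow
    obtain ⟨b, hb⟩ := (hP.image Prod.fst).bddAbove
    refine ⟨(b - a + 1).toNat, (1 - a, t), fun p hp => ⟨?_, h _ ⟨p, hp, rfl⟩⟩⟩
    have h1 := ha ⟨p, hp, rfl⟩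
    have h2 := hb ⟨p, hp, rfl⟩
    constructor
    · simp; linarith
    · simp; omega

theorem fitsHeight_congr {P Q : Set (ℤ × ℤ)} (hP : P.Finite) (hQ : Q.Finite)
    (h : Prod.snd '' P = Prod.snd '' Q) (k : ℕ) : FitsHeight P k ↔ FitsHeight Q k := by
  rw [fitsHeight_iff hP, fitsHeight_iff hQ, h]

theorem isExactHeight_congr {P Q : Set (ℤ × ℤ)} (hP : P.Finite) (hQ : Q.Finite)
    (h : Prod.snd '' P = Prod.snd '' Q) (k : ℕ) : IsExactHeight P k ↔ IsExactHeight Q k := by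
  simp only [IsExactHeight, fitsHeight_congr hP hQ h]

namespace FlatVisibilityRepresentation

variable {V : Type*} {G : SimpleGraph V} (D : FlatVisibilityRepresentation G)

/-- The column in which the edge `uv` is attached to `u`. -/
def col (u v : V) : ℤ := (D.attach u v).1

theorem attach_mem {u v : V} (h : G.Adj u v) :
    (D.attach u v).2 = D.row u ∧ D.left u ≤ D.col u v ∧ D.col u v ≤ D.right u := by
  have h1 : toPlane (D.attach u v) ∈ ({toPlane (D.attach u v)} : Set (ℝ × ℝ)) := rfl
  rw [← D.attached u v h] at h1
  exact mk_mem_flatBox.1 h1.2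

theorem points_finite [Finite V] : D.points.Finite := by
  refine Set.Finite.union ?_ ?_
  · refine ((Set.finite_range fun v => (D.left v, D.row v)).union
      (Set.finite_range fun v => (D.right v, D.row v))).subset ?_
    rintro p ⟨v, rfl | rfl⟩
    · exact .inl ⟨v, rfl⟩
    · exact .inr ⟨v, rfl⟩
  · refine (Set.finite_range fun q : V × V => D.attach q.1 q.2).subset ?_
    rintro p ⟨u, v, -, rfl⟩
    exact ⟨(u, v), rfl⟩

theorem snd_image_points : Prod.snd '' D.points = Set.range D.row := by
  ext y
  constructor
  · rintro ⟨p, ⟨v, rfl | rfl⟩ | ⟨u, v, h, rfl⟩, rfl⟩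
    · exact ⟨v, rfl⟩
    · exact ⟨v, rfl⟩
    · exact ⟨u, (D.attach_mem h).1.symm⟩
  · rintro ⟨v, rfl⟩
    exact ⟨_, .inl ⟨v, .inl rfl⟩, rfl⟩

end FlatVisibilityRepresentation

theorem StraightLineDrawing.points_finite {V : Type*} [Finite V] {G : SimpleGraph V}
    (D : StraightLineDrawing G) : D.points.Finite := Set.finite_range _

theorem snd_image_points_eq {V : Type*} {G : SimpleGraph V} {D : StraightLineDrawing G}
    {D' : FlatVisibilityRepresentation G} (h : ∀ v, D'.row v = (D.pos v).2) :
    Prod.snd '' D.points = Prod.snd '' D'.points := by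
  rw [D'.snd_image_points, StraightLineDrawing.points, ← Set.range_comp]
  congr 1
  exact funext fun v => (h v).symm

/-! ### Monotone harmonic functions on a grid of levels -/

/-- A subdivision of every level of the grid `ℤ × ℤ` into intervals: the point `x` of level `j` lies
in `[lo j x, hi j x]`. Some of the points are rigid, among them those outside of `(A, B)`. -/
structure LevelGrid where
  A : ℤ
  B : ℤ
  A_lt_B : A < B
  lo : ℤ → ℤ → ℤ
  hi : ℤ → ℤ → ℤ
  rigid : ℤ → ℤ → Prop
  lo_le : ∀ j x, lo j x ≤ x
  le_hi : ∀ j x, x ≤ hi j x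
  sep : ∀ j x x', x < x' → hi j x < lo j x' ∨ (lo j x = lo j x' ∧ hi j x = hi j x')
  rigid_eq : ∀ j x, rigid j x → lo j x = x ∧ hi j x = x
  rigid_left : ∀ j x, x ≤ A → rigid j x
  rigid_right : ∀ j x, B ≤ x → rigid j x

namespace LevelGrid

variable (Γ : LevelGrid)

open Classical in
/-- How far a point looks beyond its interval: not at all if it is rigid. -/
noncomputable def slack (j x : ℤ) : ℤ := if Γ.rigid j x then 0 else 1

theorem slack_nonneg (j x : ℤ) : 0 ≤ Γ.slack j x := by
  unfold slack; split_ifs <;> norm_num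

theorem slack_le (j x : ℤ) : Γ.slack j x ≤ 1 := by
  unfold slack; split_ifs <;> norm_num

theorem slack_of_rigid {j x : ℤ} (h : Γ.rigid j x) : Γ.slack j x = 0 := if_pos h

theorem rigid_of_slack {j x : ℤ} (h : Γ.slack j x ≤ 0) : Γ.rigid j x := by
  by_contra hn
  rw [slack, if_neg hn] at h
  norm_num at h

/-- The left end of what a point looks at in the neighbouring levels. -/
noncomputable def farLeft (j x : ℤ) : ℤ := Γ.lo j x - Γ.slack j x

/-- The right end of what a point looks at in the neighbouring levels. -/
noncomputable def farRight (j x : ℤ) : ℤ := Γ.hi j x + Γ.slack j x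

theorem farLeft_le (j x : ℤ) : Γ.farLeft j x ≤ x := by
  have := Γ.lo_le j x
  have := Γ.slack_nonneg j x
  unfold farLeft; omega

theorem le_farRight (j x : ℤ) : x ≤ Γ.farRight j x := by
  have := Γ.le_hi j x
  have := Γ.slack_nonneg j x
  unfold farRight; omega

theorem farLeft_le_lo (j x : ℤ) : Γ.farLeft j x ≤ Γ.lo j x := by
  have := Γ.slack_nonneg j x
  unfold farLeft; omega

theorem lo_le_farRight (j x : ℤ) : Γ.lo j x ≤ Γ.farRight j x :=
  (Γ.lo_le j x).trans (Γ.le_farRight j x)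

theorem hi_eq_of_lo_eq {j x x' : ℤ} (hx : x < x') (h : Γ.lo j x = Γ.lo j x') :
    Γ.hi j x = Γ.hi j x' := by
  rcases Γ.sep j x x' hx with h1 | h1
  · have := Γ.lo_le j x
    have := Γ.le_hi j x
    omega
  · exact h1.2

theorem not_rigid_of_lo_eq {j x x' : ℤ} (hx : x < x') (h : Γ.lo j x = Γ.lo j x') :
    ¬ Γ.rigid j x ∧ ¬ Γ.rigid j x' := by
  have h1 := Γ.hi_eq_of_lo_eq hx h
  have h2 := Γ.lo_le j x
  have h3 := Γ.le_hi j x'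
  constructor
  · intro hr
    have := Γ.rigid_eq j x hr
    omega
  · intro hr
    have := Γ.rigid_eq j x' hr
    omega

theorem far_eq_of_lo_eq {j x x' : ℤ} (hx : x < x') (h : Γ.lo j x = Γ.lo j x') :
    Γ.farLeft j x = Γ.farLeft j x' ∧ Γ.farRight j x = Γ.farRight j x' := by
  have h1 := Γ.hi_eq_of_lo_eq hx h
  obtain ⟨h2, h3⟩ := Γ.not_rigid_of_lo_eq hx h
  simp [farLeft, farRight, slack, h1, h2, h3, h]

/-- Distinct intervals are disjoint sets of integers, so looking one step beyond an interval does
not pass the near end of the next one. -/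
theorem lo_le_farLeft {j x x' : ℤ} (hx : x < x') (h : Γ.lo j x ≠ Γ.lo j x') :
    Γ.lo j x ≤ Γ.farLeft j x' ∧ Γ.farRight j x ≤ Γ.lo j x' := by
  rcases Γ.sep j x x' hx with h1 | h1
  · have := Γ.lo_le j x
    have := Γ.le_hi j x
    have := Γ.slack_le j x
    have := Γ.slack_le j x'
    unfold farLeft farRight
    omega
  · exact absurd h1.1 h

theorem far_mono {j x x' : ℤ} (hx : x ≤ x') :
    Γ.farLeft j x ≤ Γ.farLeft j x' ∧ Γ.lo j x ≤ Γ.lo j x' ∧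
      Γ.farRight j x ≤ Γ.farRight j x' := by
  rcases hx.eq_or_lt with rfl | hx
  · simp
  by_cases h : Γ.lo j x = Γ.lo j x'
  · obtain ⟨h1, h2⟩ := Γ.far_eq_of_lo_eq hx h
    exact ⟨h1.le, h.le, h2.le⟩
  · obtain ⟨h1, h2⟩ := Γ.lo_le_farLeft hx h
    exact ⟨(Γ.farLeft_le_lo j x).trans h1, h1.trans (Γ.farLeft_le_lo j x'),
      h2.trans (Γ.lo_le_farRight j x')⟩

/-- The sum of the values that the point `x` of level `j` sees in a neighbouring level. -/
noncomputable def look (f : ℤ → ℝ) (j x : ℤ) : ℝ :=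
  f (Γ.farLeft j x) + f (Γ.lo j x) + f (Γ.farRight j x)

/-- The average of the values that the point `x` of level `j` sees in the neighbouring levels. -/
noncomputable def average (F : ℤ → ℤ → ℝ) (j x : ℤ) : ℝ :=
  (Γ.look (F (j + 1)) j x + Γ.look (F (j - 1)) j x) / 6

/-- The three sampled columns coincide at a rigid point. Harmonicity there is the vertical mean
value property, which later makes edges straight. -/
theorem look_of_rigid (f : ℤ → ℝ) {j x : ℤ} (h : Γ.rigid j x) : Γ.look f j x = 3 * f x := by
  obtain ⟨h1, h2⟩ := Γ.rigid_eq j x h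
  simp only [look, farLeft, farRight, h1, h2, Γ.slack_of_rigid h, sub_zero, add_zero]
  ring

theorem average_of_rigid (F : ℤ → ℤ → ℝ) {j x : ℤ} (h : Γ.rigid j x) :
    Γ.average F j x = (F (j + 1) x + F (j - 1) x) / 2 := by
  rw [average, look_of_rigid Γ _ h, look_of_rigid Γ _ h]; ring

theorem look_mono {f : ℤ → ℝ} (hf : Monotone f) (j : ℤ) : Monotone (Γ.look f j) := by
  intro x x' hx
  obtain ⟨h1, h2, h3⟩ := Γ.far_mono (j := j) hx
  exact add_le_add (add_le_add (hf h1) (hf h2)) (hf h3)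

theorem average_mono {F : ℤ → ℤ → ℝ} (hF : ∀ j, Monotone (F j)) (j : ℤ) :
    Monotone (Γ.average F j) := by
  intro x x' hx
  have h1 := Γ.look_mono (hF (j + 1)) j hx
  have h2 := Γ.look_mono (hF (j - 1)) j hx
  unfold average
  linarith

theorem average_le_average {F F' : ℤ → ℤ → ℝ} (h : ∀ j x, F j x ≤ F' j x) (j x : ℤ) :
    Γ.average F j x ≤ Γ.average F' j x := by
  unfold average look
  gcongr <;> exact h _ _

theorem average_const (c : ℝ) (j x : ℤ) : Γ.average (fun _ _ => c) j x = c := by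
  simp only [average, look]; ring

theorem average_mem (F : ℤ → ℤ → unitInterval) (j x : ℤ) :
    Γ.average (fun j x => (F j x : ℝ)) j x ∈ unitInterval := by
  constructor
  · rw [← Γ.average_const 0 j x]
    exact Γ.average_le_average (fun j x => (F j x).2.1) j x
  · rw [← Γ.average_const 1 j x]
    exact Γ.average_le_average (fun j x => (F j x).2.2) j x

/-- One averaging step, with fixed values at the walls. -/
noncomputable def step (F : ℤ → ℤ → unitInterval) (j x : ℤ) : unitInterval :=
  if x ≤ Γ.A then 0 else if Γ.B ≤ x then 1 else ⟨_, Γ.average_mem F j x⟩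

theorem step_monotone : Monotone Γ.step := by
  intro F F' h j x
  unfold step
  split_ifs
  · exact le_rfl
  · exact le_rfl
  · exact Γ.average_le_average (fun j x => h j x) j x

theorem step_level_monotone {F : ℤ → ℤ → unitInterval} (hF : ∀ j, Monotone (F j)) (j : ℤ) :
    Monotone (Γ.step F j) := by
  intro x x' hx
  by_cases h1 : x ≤ Γ.A
  · rw [step, if_pos h1]; exact unitInterval.nonneg _
  by_cases h2 : Γ.B ≤ x'
  · have h3 : ¬ x' ≤ Γ.A := by have := Γ.A_lt_B; omega
    rw [step, step, if_neg h3, if_pos h2]; exact unitInterval.le_one _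
  rw [step, step, if_neg h1, if_neg (by omega), if_neg (by omega), if_neg h2]
  exact Γ.average_mono (F := fun j x => (F j x : ℝ)) (fun j x y h => hF j h) j hx

/-- There is a monotone harmonic function on the grid. -/
theorem exists_harmonic : ∃ F : ℤ → ℤ → ℝ, (∀ j, Monotone (F j)) ∧
    (∀ j x, x ≤ Γ.A → F j x = 0) ∧ (∀ j x, Γ.B ≤ x → F j x = 1) ∧
    ∀ j x, F j x = Γ.average F j x := by
  -- With values in the complete lattice `unitInterval`, Knaster–Tarski gives a harmonic function on
  -- the infinite grid without any linear algebra.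
  let T : (ℤ → ℤ → unitInterval) →o (ℤ → ℤ → unitInterval) := ⟨Γ.step, Γ.step_monotone⟩
  let F := T.lfp
  have hfix : Γ.step F = F := T.map_lfp
  have hmono : ∀ j, Monotone (F j) := by
    -- Monotonicity within levels is preserved by a step and by suprema, hence inherited by the
    -- least fixed point.
    refine T.lfp_induction (p := fun F => ∀ j, Monotone (F j)) ?_ ?_
    · exact fun F hF _ => Γ.step_level_monotone hF
    · intro s hs j x x' hx
      simp only [sSup_apply, iSup_apply]
      exact iSup_mono fun F => hs _ F.2 j hx
  have hA : ∀ j x, x ≤ Γ.A → (F j x : ℝ) = 0 := fun j x h => by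
    rw [← hfix, step, if_pos h]; rfl
  have hB : ∀ j x, Γ.B ≤ x → (F j x : ℝ) = 1 := fun j x h => by
    have h3 : ¬ x ≤ Γ.A := by have := Γ.A_lt_B; omega
    rw [← hfix, step, if_neg h3, if_pos h]; rfl
  refine ⟨fun j x => F j x, fun j x y h => hmono j h, hA, hB, fun j x => ?_⟩
  -- At and beyond the walls the points are rigid and the prescribed value is the same on all
  -- levels, so the averaging equation holds there too.
  by_cases h1 : x ≤ Γ.A
  · simp only [Γ.average_of_rigid _ (Γ.rigid_left j x h1), hA _ _ h1]; norm_num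
  by_cases h2 : Γ.B ≤ x
  · simp only [Γ.average_of_rigid _ (Γ.rigid_right j x h2), hB _ _ h2]; norm_num
  · have h3 : F j x = ⟨_, Γ.average_mem F j x⟩ := by
      conv_lhs => rw [← hfix]
      unfold step
      rw [if_neg h1, if_neg h2]
    exact congrArg Subtype.val h3

variable {Γ}

/-- If two intervals of a level get the same value, so does all they see. -/
theorem eq_far_of_eq {F : ℤ → ℤ → ℝ} (hF : ∀ j, Monotone (F j))
    (hav : ∀ j x, F j x = Γ.average F j x) {j p q : ℤ} (hpq : p < q) (h : Γ.lo j p ≠ Γ.lo j q)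
    (he : F j p = F j q) :
    F (j + 1) (Γ.farLeft j p) = F (j + 1) (Γ.farRight j q) ∧
      F (j - 1) (Γ.farLeft j p) = F (j - 1) (Γ.farRight j q) := by
  rw [hav j p, hav j q, average, average] at he
  have l1 := Γ.look_mono (hF (j + 1)) j hpq.le
  have l2 := Γ.look_mono (hF (j - 1)) j hpq.le
  -- Equal sums of termwise ordered values force equality term by term. The left ends enclose `lo j
  -- p` and the right ends enclose `lo j q`. The middle terms equate the values at these two points
  -- and so link both chains.
  have key : ∀ f : ℤ → ℝ, Monotone f → Γ.look f j p = Γ.look f j q →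
      f (Γ.farLeft j p) = f (Γ.farRight j q) := by
    intro f hf e
    obtain ⟨h1, h2, h3⟩ := Γ.far_mono (j := j) hpq.le
    obtain ⟨h4, h5⟩ := Γ.lo_le_farLeft hpq h
    have := hf h1
    have := hf h2
    have := hf h3
    have := hf h4
    have := hf h5
    have := hf (Γ.farLeft_le_lo j p)
    have := hf (Γ.lo_le_farRight j q)
    unfold look at e
    linarith
  exact ⟨key _ (hF _) (by linarith), key _ (hF _) (by linarith)⟩

theorem A_le_farLeft {j p : ℤ} (h : Γ.A ≤ p) : Γ.A ≤ Γ.farLeft j p := by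
  rcases h.eq_or_lt with h | h
  · have hr := Γ.rigid_left j p h.ge
    rw [farLeft, (Γ.rigid_eq j p hr).1, Γ.slack_of_rigid hr]; omega
  · have h1 := Γ.rigid_eq j _ (Γ.rigid_left j _ le_rfl)
    have h2 := Γ.le_hi j p
    have h3 := Γ.slack_le j p
    rw [farLeft]
    rcases Γ.sep j _ _ h with h4 | h4 <;> omega

theorem farRight_le_B {j p : ℤ} (h : p ≤ Γ.B) : Γ.farRight j p ≤ Γ.B := by
  rcases h.eq_or_lt with h | h
  · have hr := Γ.rigid_right j p h.ge
    rw [farRight, (Γ.rigid_eq j p hr).2, Γ.slack_of_rigid hr]; omega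
  · have h1 := Γ.rigid_eq j _ (Γ.rigid_right j _ le_rfl)
    have h2 := Γ.lo_le j p
    have h3 := Γ.slack_le j p
    rw [farRight]
    rcases Γ.sep j _ _ h with h4 | h4 <;> omega

/-- A monotone harmonic function separates the intervals of each level, provided that no two rigid
columns run in parallel between the same two intervals. -/
theorem strict_of_harmonic {F : ℤ → ℤ → ℝ} (hF : ∀ j, Monotone (F j))
    (hA : ∀ j x, x ≤ Γ.A → F j x = 0) (hB : ∀ j x, Γ.B ≤ x → F j x = 1)
    (hav : ∀ j x, F j x = Γ.average F j x)
    (thin : ∀ j, (∀ x, Γ.lo (j + 1) x = x) ∨ ∀ x, Γ.lo (j - 1) x = x)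
    (noparallel : ∀ p q, p < q → Γ.A ≤ p → q ≤ Γ.B → (Γ.A < p ∨ q < Γ.B) → ∀ T : ℤ → Prop,
      (∀ j, T j → Γ.rigid j p ∧ Γ.rigid j q) →
      (∀ j, T j → T (j + 1) ∨ Γ.lo (j + 1) p = Γ.lo (j + 1) q) →
      (∀ j, T j → T (j - 1) ∨ Γ.lo (j - 1) p = Γ.lo (j - 1) q) → ∀ j, ¬ T j)
    {j p q : ℤ} (hp : Γ.A ≤ p) (hq : q ≤ Γ.B) (hpq : p < q) (h : Γ.lo j p ≠ Γ.lo j q) :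
    F j p < F j q := by
  let Tie (j p q : ℤ) : Prop := Γ.A ≤ p ∧ q ≤ Γ.B ∧ p < q ∧ Γ.lo j p ≠ Γ.lo j q ∧ F j p = F j q
  by_contra hlt
  have h0 : Tie j p q := ⟨hp, hq, hpq, h, le_antisymm (hF j hpq.le) (not_lt.1 hlt)⟩
  -- Pass to a tie of maximal width `q - p`; widths are bounded by the distance of the walls.
  obtain ⟨n, ⟨j, p, q, h0, hn⟩, hmax⟩ := Int.exists_greatest_of_bdd
    (P := fun n => ∃ j p q, Tie j p q ∧ q - p = n)
    ⟨Γ.B - Γ.A, by rintro n ⟨j, p, q, ⟨h1, h2, -⟩, rfl⟩; omega⟩ ⟨_, j, p, q, h0, rfl⟩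
  clear hp hq hpq h hlt
  have widen : ∀ j, Tie j p q → ∀ j', (j' = j + 1 ∨ j' = j - 1) →
      Γ.lo j' (Γ.farLeft j p) ≠ Γ.lo j' (Γ.farRight j q) →
      Γ.farLeft j p = p ∧ Γ.farRight j q = q := by
    rintro j ⟨h1, h2, h3, h4, h5⟩ j' hj' hne
    have h6 := Γ.farLeft_le j p
    have h7 := Γ.le_farRight j q
    have h8 := eq_far_of_eq hF hav h3 h4 h5
    have := hmax _ ⟨j', Γ.farLeft j p, Γ.farRight j q, ⟨A_le_farLeft h1, farRight_le_B h2,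
      by omega, hne, by rcases hj' with rfl | rfl; exacts [h8.1, h8.2]⟩, rfl⟩
    omega
  -- Some neighbouring level consists of single points, so the columns seen from `p` and `q` form a
  -- tie there. By maximality it is no wider, which forces both points to be rigid.
  have rig : ∀ j, Tie j p q → Γ.farLeft j p = p ∧ Γ.farRight j q = q := by
    intro j hT
    have h3 := hT.2.2.1
    have h6 := Γ.farLeft_le j p
    have h7 := Γ.le_farRight j q
    rcases thin j with ht | ht
    · exact widen j hT _ (.inl rfl) (by rw [ht, ht]; omega)
    · exact widen j hT _ (.inr rfl) (by rw [ht, ht]; omega)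
  have hpq := h0.2.2.1
  refine noparallel p q hpq h0.1 h0.2.1 ?_ (fun j => Tie j p q) ?_ ?_ ?_ j h0
  -- The pair cannot consist of both walls, whose values are 0 and 1.
  · by_contra hcon
    have := h0.2.2.2.2
    rw [hA _ _ (by omega), hB _ _ (by omega)] at this
    norm_num at this
  · intro j hT
    obtain ⟨h1, h2⟩ := rig j hT
    have := Γ.lo_le j p
    have := Γ.le_hi j q
    unfold farLeft at h1
    unfold farRight at h2
    exact ⟨Γ.rigid_of_slack (by omega), Γ.rigid_of_slack (by omega)⟩
  · intro j hT
    obtain ⟨h1, h2⟩ := rig j hT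
    have := (eq_far_of_eq hF hav hpq hT.2.2.2.1 hT.2.2.2.2).1
    rw [h1, h2] at this
    by_cases h : Γ.lo (j + 1) p = Γ.lo (j + 1) q
    · exact .inr h
    · exact .inl ⟨hT.1, hT.2.1, hpq, h, this⟩
  · intro j hT
    obtain ⟨h1, h2⟩ := rig j hT
    have := (eq_far_of_eq hF hav hpq hT.2.2.2.1 hT.2.2.2.2).2
    rw [h1, h2] at this
    by_cases h : Γ.lo (j - 1) p = Γ.lo (j - 1) q
    · exact .inr h
    · exact .inl ⟨hT.1, hT.2.1, hpq, h, this⟩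

/-- What a point sees depends only on its interval, so a harmonic function is constant on intervals.
-/
theorem eq_of_lo_eq {F : ℤ → ℤ → ℝ} (hav : ∀ j x, F j x = Γ.average F j x) {j p q : ℤ}
    (h : Γ.lo j p = Γ.lo j q) : F j p = F j q := by
  rw [hav j p, hav j q]
  rcases lt_trichotomy p q with hpq | rfl | hpq
  · obtain ⟨h1, h2⟩ := Γ.far_eq_of_lo_eq hpq h
    simp only [average, look, h, h1, h2]
  · rfl
  · obtain ⟨h1, h2⟩ := Γ.far_eq_of_lo_eq hpq h.symm
    simp only [average, look, h, h1, h2]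

end LevelGrid

theorem eq_affine_of_eq_average {g : ℤ → ℝ} {a b : ℤ}
    (h : ∀ j, a < j → j < b → g j = (g (j + 1) + g (j - 1)) / 2) {j : ℤ} (hj : a < j)
    (hjb : j < b) :
    g j = g a + (g b - g a) * ((j - a : ℝ) / (b - a)) := by
  -- The mean value property says that consecutive increments agree; carrying two consecutive values
  -- through the induction expresses this.
  have key : ∀ n : ℕ, a + n + 1 ≤ b → g (a + n) = g a + n * (g (a + 1) - g a) ∧
      g (a + n + 1) = g a + (n + 1) * (g (a + 1) - g a) := by
    intro n
    induction n with
    | zero => intro _; simp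
    | succ n ih =>
      intro hn
      push_cast at hn ⊢
      obtain ⟨h1, h2⟩ := ih (by omega)
      have h3 := h (a + n + 1) (by omega) (by omega)
      rw [show a + (n : ℤ) + 1 - 1 = a + n by ring] at h3
      rw [← add_assoc]
      exact ⟨h2, by linarith⟩
  obtain ⟨n, rfl⟩ := Int.le.dest hj.le
  obtain ⟨m, rfl⟩ := Int.le.dest (show a + 1 ≤ b by omega)
  have h1 := (key n (by omega)).1
  have h2 := (key m (by omega)).2
  rw [show a + (m : ℤ) + 1 = a + 1 + m by ring] at h2
  rw [h1, h2]
  push_cast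
  have : (m : ℝ) + 1 ≠ 0 := by positivity
  have e : ((a : ℝ) + 1 + m - a) = m + 1 := by ring
  rw [e]
  field_simp
  ring

/-- Two flat edges of a row, neither of which spans another vertex, do not overlap. -/
theorem flat_edges_apart {V : Type*} {G : SimpleGraph V} {x r : V → ℤ}
    (inj : ∀ u v, r u = r v → x u = x v → u = v)
    (gap : ∀ u v w, G.Adj u v → r u = r v → r w = r u → x u < x w → x w < x v → False)
    {u v u' v' : V} (h : G.Adj u v) (h' : G.Adj u' v') (hr : r u = r v) (hr' : r u' = r v')
    (hrr : r u = r u') (hx : x u < x v) (hx' : x u' < x v') (hne : s(u, v) ≠ s(u', v')) :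
    x v ≤ x u' ∨ x v' ≤ x u := by
  by_contra hcon
  push Not at hcon
  rcases lt_trichotomy (x u) (x u') with h1 | h1 | h1
  · exact gap u v u' h hr hrr.symm h1 hcon.1
  · obtain rfl := inj u u' hrr h1
    rcases lt_trichotomy (x v) (x v') with h2 | h2 | h2
    · exact gap _ _ _ h' hr' hr.symm hx h2
    · obtain rfl := inj v v' (hr.symm.trans hr') h2
      exact hne rfl
    · exact gap _ _ _ h hr hr'.symm hx' h2
  · exact gap u' v' u h' hr' hrr h1 hcon.2

/-! ### Left-to-right order in a flat visibility representation -/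

namespace FlatVisibilityRepresentation

variable {V : Type*} {G : SimpleGraph V} (D : FlatVisibilityRepresentation G)

theorem col_comm {u v : V} (h : G.Adj u v) (hr : D.row u ≠ D.row v) : D.col u v = D.col v u := by
  rcases D.axis_parallel u v h with h1 | h1
  · exact h1
  · rw [(D.attach_mem h).1, (D.attach_mem h.symm).1] at h1
    exact absurd h1 hr

theorem col_mem_right {u v : V} (h : G.Adj u v) (hr : D.row u ≠ D.row v) :
    D.left v ≤ D.col u v ∧ D.col u v ≤ D.right v := by
  rw [D.col_comm h hr]; exact (D.attach_mem h.symm).2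

theorem mem_curve_vertical {u v : V} (h : G.Adj u v) (hr : D.row u < D.row v) (z : ℝ × ℝ) :
    z ∈ gridSegment (D.attach u v) (D.attach v u) ↔
      (D.row u : ℝ) ≤ z.2 ∧ z.2 ≤ D.row v ∧ z.1 = D.col u v := by
  have h1 := (D.attach_mem h).1
  have h2 := (D.attach_mem h.symm).1
  rw [mem_gridSegment_vertical (by rw [h1, h2]; exact hr) (D.col_comm h hr.ne), h1, h2]
  rfl

theorem mem_curve_of_between {u v : V} (h : G.Adj u v) (hr : D.row u = D.row v) {c : ℤ}
    (hu : D.right u ≤ c) (hv : c ≤ D.left v) :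
    ((c : ℝ), (D.row u : ℝ)) ∈ gridSegment (D.attach u v) (D.attach v u) := by
  obtain ⟨h1, h1l, h1r⟩ := D.attach_mem h
  obtain ⟨h2, h2l, h2r⟩ := D.attach_mem h.symm
  rw [mem_gridSegment_horizontal (by rw [h1, h2]; exact hr)
    (show D.col u v ≤ D.col v u by omega), h1]
  have h3 : D.col u v ≤ c := by omega
  have h4 : c ≤ D.col v u := by omega
  exact ⟨rfl, Int.cast_le.2 h3, Int.cast_le.2 h4⟩

variable {D} (hD : D.IsPlanar)
include hD

theorem IsPlanar.eq_of_mem {v w : V} {c : ℤ} (hr : D.row v = D.row w)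
    (hv : D.left v ≤ c ∧ c ≤ D.right v) (hw : D.left w ≤ c ∧ c ≤ D.right w) : v = w := by
  by_contra hne
  exact Set.disjoint_left.1 (hD.vertex_vertex v w hne)
    (mk_mem_flatBox.2 ⟨rfl, hv⟩ : ((c : ℝ), (D.row v : ℝ)) ∈ _) (mk_mem_flatBox.2 ⟨hr, hw⟩)

theorem IsPlanar.right_lt_left {v w : V} (hr : D.row v = D.row w) (hne : v ≠ w) {c d : ℤ}
    (hv : D.left v ≤ c ∧ c ≤ D.right v) (hw : D.left w ≤ d ∧ d ≤ D.right w) (hcd : c ≤ d) :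
    D.right v < D.left w := by
  by_contra hlt
  by_cases h : D.left w ≤ c
  · exact hne (hD.eq_of_mem hr hv ⟨h, by omega⟩)
  · exact hne (hD.eq_of_mem (c := D.left w) hr (by omega) ⟨le_rfl, by omega⟩)

theorem IsPlanar.right_lt_left_or {v w : V} (hr : D.row v = D.row w) (hne : v ≠ w) :
    D.right v < D.left w ∨ D.right w < D.left v := by
  have hv := D.left_le_right v
  have hw := D.left_le_right w
  rcases le_total (D.left v) (D.left w) with h | h
  · exact .inl (hD.right_lt_left hr hne ⟨le_rfl, hv⟩ ⟨le_rfl, hw⟩ h)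
  · exact .inr (hD.right_lt_left hr.symm hne.symm ⟨le_rfl, hw⟩ ⟨le_rfl, hv⟩ h)

theorem IsPlanar.col_lt_or_lt {u v w : V} (h : G.Adj u v) (hu : D.row u < D.row w)
    (hv : D.row w < D.row v) : D.col u v < D.left w ∨ D.right w < D.col u v := by
  by_contra hcon
  push Not at hcon
  have hne1 : w ≠ u := by rintro rfl; exact hu.false
  have hne2 : w ≠ v := by rintro rfl; exact hv.false
  have hp : ((D.col u v : ℝ), (D.row w : ℝ)) ∈ gridSegment (D.attach u v) (D.attach v u) :=
    (D.mem_curve_vertical h (hu.trans hv) _).2 ⟨Int.cast_le.2 hu.le, Int.cast_le.2 hv.le, rfl⟩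
  exact Set.disjoint_left.1 (hD.edge_vertex u v w h hne1 hne2) hp (mk_mem_flatBox.2 ⟨rfl, hcon⟩)

/-- In a common column the two edges would share a point at a height strictly inside both vertical
ranges, where neither has an end. -/
theorem IsPlanar.col_ne {u v u' v' : V} (h : G.Adj u v) (h' : G.Adj u' v')
    (hne : s(u, v) ≠ s(u', v')) (h1 : D.row u < D.row v) (h2 : D.row u < D.row v')
    (h3 : D.row u' < D.row v) (h4 : D.row u' < D.row v') : D.col u v ≠ D.col u' v' := by
  intro hc
  have hlt : max (D.row u : ℝ) (D.row u') < min (D.row v : ℝ) (D.row v') := by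
    rw [max_lt_iff, lt_min_iff, lt_min_iff]
    exact ⟨⟨Int.cast_lt.2 h1, Int.cast_lt.2 h2⟩, Int.cast_lt.2 h3, Int.cast_lt.2 h4⟩
  obtain ⟨y, hy1, hy2⟩ := exists_between hlt
  rw [max_lt_iff] at hy1
  rw [lt_min_iff] at hy2
  obtain ⟨w, hw, -, hp⟩ := hD.edge_edge u v u' v' h h' hne ((D.col u v : ℝ), y)
    ⟨(D.mem_curve_vertical h h1 _).2 ⟨hy1.1.le, hy2.1.le, rfl⟩,
      (D.mem_curve_vertical h' h4 _).2 ⟨hy1.2.le, hy2.2.le, by rw [hc]⟩⟩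
  have := (mem_flatBox.1 hp).1
  rcases Sym2.mem_iff.1 hw with rfl | rfl
  · exact hy1.1.ne this.symm
  · exact hy2.1.ne this

theorem IsPlanar.not_between {u v w : V} (h : G.Adj u v) (hr : D.row u = D.row v)
    (hw : D.row w = D.row u) (h1 : D.right u < D.left w) (h2 : D.right w < D.left v) : False := by
  have := D.left_le_right u
  have := D.left_le_right v
  have := D.left_le_right w
  have hne1 : w ≠ u := by rintro rfl; omega
  have hne2 : w ≠ v := by rintro rfl; omega
  exact Set.disjoint_left.1 (hD.edge_vertex u v w h hne1 hne2)
    (D.mem_curve_of_between h hr h1.le (by omega)) (mk_mem_flatBox.2 ⟨hw.symm, le_rfl, by omega⟩)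

theorem IsPlanar.not_col_between {u v u' v' : V} (h : G.Adj u v) (hr : D.row u = D.row v)
    (h' : G.Adj u' v') (h1 : D.row u' < D.row u) (h2 : D.row u < D.row v')
    (h3 : D.right u < D.col u' v') (h4 : D.col u' v' < D.left v) : False := by
  have hne : s(u, v) ≠ s(u', v') := by
    intro e
    rcases Sym2.eq_iff.1 e with ⟨rfl, rfl⟩ | ⟨rfl, rfl⟩ <;> omega
  obtain ⟨w, hw, -, hp⟩ := hD.edge_edge u v u' v' h h' hne
    ((D.col u' v' : ℝ), (D.row u : ℝ)) ⟨D.mem_curve_of_between h hr h3.le h4.le,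
      (D.mem_curve_vertical h' (h1.trans h2) _).2
        ⟨Int.cast_le.2 h1.le, Int.cast_le.2 h2.le, rfl⟩⟩
  have := (mk_mem_flatBox.1 hp).2
  rcases Sym2.mem_iff.1 hw with rfl | rfl <;> omega

omit hD
variable (D)

/-- Abscissas for the vertices which, with edges drawn straight, keep the left-to-right order of
vertices and edges in every row of `D`. -/
def Faithful (x : V → ℝ) : Prop :=
  (∀ w w', D.row w = D.row w' → D.right w < D.left w' → x w < x w') ∧
  (∀ u v w, G.Adj u v → D.row u < D.row w → D.row w < D.row v → D.col u v < D.left w →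
    crossing x D.row u v (D.row w) < x w) ∧
  (∀ u v w, G.Adj u v → D.row u < D.row w → D.row w < D.row v → D.right w < D.col u v →
    x w < crossing x D.row u v (D.row w)) ∧
  ∀ u v u' v' w, G.Adj u v → G.Adj u' v' → D.row u < D.row w → D.row w < D.row v →
    D.row u' < D.row w → D.row w < D.row v' → D.col u v < D.col u' v' →
    crossing x D.row u v (D.row w) < crossing x D.row u' v' (D.row w)

/-- Finitely many strict inequalities between functions continuous in `x`. -/
theorem isOpen_faithful [Finite V] : IsOpen {x | D.Faithful x} := by
  unfold Faithful crossing
  simp only [Set.ofPred_and, Set.ofPred_forall]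
  refine .inter ?_ (.inter ?_ (.inter ?_ ?_)) <;>
  · repeat refine isOpen_iInter_of_finite fun _ => ?_
    exact isOpen_lt (by fun_prop) (by fun_prop)

/-- Openness gives rational abscissas; multiplying by a common denominator keeps every inequality
because crossings scale along. -/
theorem exists_int_faithful [Finite V] {x : V → ℝ} (hx : D.Faithful x) :
    ∃ X : V → ℤ, D.Faithful fun v => (X v : ℝ) := by
  have hd : DenseRange (fun (q : V → ℚ) v => (q v : ℝ)) :=
    DenseRange.piMap fun _ => Rat.denseRange_cast
  obtain ⟨q, hq⟩ := hd.exists_mem_open D.isOpen_faithful ⟨x, hx⟩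
  cases nonempty_fintype V
  have hN : (0 : ℚ) < ∏ v, ((q v).den : ℚ) :=
    Finset.prod_pos fun v _ => by exact_mod_cast (q v).den_pos
  have hX : ∀ v, ∃ k : ℤ, (k : ℚ) = (∏ v, ((q v).den : ℚ)) * q v := by
    intro v
    classical
    refine ⟨(∏ w ∈ Finset.univ.erase v, ((q w).den : ℤ)) * (q v).num, ?_⟩
    rw [← Finset.mul_prod_erase _ _ (Finset.mem_univ v)]
    push_cast
    rw [← Rat.mul_den_eq_num (q v)]
    ring
  choose X hX using hX
  refine ⟨X, ?_⟩
  have e : (fun v => (X v : ℝ)) = fun v => ((∏ v, ((q v).den : ℚ) : ℚ) : ℝ) * (q v : ℝ) :=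
    funext fun v => by exact_mod_cast congrArg (Rat.cast : ℚ → ℝ) (hX v)
  have hN' : (0 : ℝ) < ((∏ v, ((q v).den : ℚ) : ℚ) : ℝ) := by exact_mod_cast hN
  rw [e]
  obtain ⟨h1, h2, h3, h4⟩ := hq
  refine ⟨?_, ?_, ?_, ?_⟩ <;> intros <;> simp only [crossing_const_mul] <;>
    refine mul_lt_mul_of_pos_left ?_ hN'
  · apply h1 <;> assumption
  · apply h2 <;> assumption
  · apply h3 <;> assumption
  · apply h4 <;> assumption

end FlatVisibilityRepresentation

/-! ### Faithful abscissas give a planar straight-line drawing -/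

namespace FlatVisibilityRepresentation

variable {V : Type*} {G : SimpleGraph V} {D : FlatVisibilityRepresentation G}

theorem Faithful.lt_iff_of_flat (hD : D.IsPlanar) {X : V → ℤ}
    (hX : D.Faithful fun v => (X v : ℝ)) {u v : V} (hr : D.row u = D.row v) :
    X u < X v ↔ D.right u < D.left v := by
  have key : ∀ {u v}, D.row u = D.row v → D.right u < D.left v → X u < X v :=
    fun h1 h2 => Int.cast_lt.1 (hX.1 _ _ h1 h2)
  refine ⟨fun h => ?_, key hr⟩
  have hne : u ≠ v := by rintro rfl; exact h.false
  exact (hD.right_lt_left_or hr hne).resolve_right fun h1 => (key hr.symm h1).not_gt h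

theorem Faithful.inj (hD : D.IsPlanar) {X : V → ℤ} (hX : D.Faithful fun v => (X v : ℝ))
    (u v : V) (hr : D.row u = D.row v) (h : X u = X v) : u = v := by
  by_contra hne
  rcases hD.right_lt_left_or hr hne with h1 | h1
  · exact ((hX.lt_iff_of_flat hD hr).2 h1).ne h
  · exact ((hX.lt_iff_of_flat hD hr.symm).2 h1).ne' h

/-- What an edge is in a row that it reaches: one of its ends, or a point between two rows. -/
theorem end_or_between (x : V → ℝ) {u v w : V} (h : G.Adj u v) (hr : D.row u < D.row v)
    (h1 : D.row u ≤ D.row w) (h2 : D.row w ≤ D.row v) :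
    (∃ z, z ∈ s(u, v) ∧ D.row z = D.row w ∧ crossing x D.row u v (D.row w) = x z ∧
      D.left z ≤ D.col u v ∧ D.col u v ≤ D.right z) ∨
      (D.row u < D.row w ∧ D.row w < D.row v) := by
  rcases h1.eq_or_lt with h1 | h1
  · exact .inl ⟨u, by simp, h1, by rw [← h1, crossing_left], (D.attach_mem h).2⟩
  rcases h2.eq_or_lt with h2 | h2
  · exact .inl ⟨v, by simp, h2.symm, by rw [h2, crossing_right _ _ hr], D.col_mem_right h hr.ne⟩
  · exact .inr ⟨h1, h2⟩

/-- In the row of `w` each edge is either at an end or strictly between its ends. Each combination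
is covered by one clause of `Faithful`, except when both edges end at the same vertex. -/
theorem Faithful.crossing_lt_or (hD : D.IsPlanar) {x : V → ℝ} (hx : D.Faithful x)
    {u v u' v' w : V} (h : G.Adj u v) (h' : G.Adj u' v') (hr : D.row u < D.row v)
    (hr' : D.row u' < D.row v') (h1 : D.row u ≤ D.row w) (h2 : D.row w ≤ D.row v)
    (h3 : D.row u' ≤ D.row w) (h4 : D.row w ≤ D.row v') (hc : D.col u v < D.col u' v') :
    crossing x D.row u v (D.row w) < crossing x D.row u' v' (D.row w) ∨
      ∃ z, z ∈ s(u, v) ∧ z ∈ s(u', v') ∧ D.row z = D.row w ∧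
        crossing x D.row u v (D.row w) = x z ∧ crossing x D.row u' v' (D.row w) = x z := by
  rcases end_or_between (D := D) x h hr h1 h2 with ⟨z, a1, a2, a3, a4⟩ | ⟨h1, h2⟩ <;>
    rcases end_or_between (D := D) x h' hr' h3 h4 with ⟨z', b1, b2, b3, b4⟩ | ⟨h3, h4⟩
  · by_cases hz : z = z'
    · subst hz
      exact .inr ⟨z, a1, b1, a2, a3, b3⟩
    · left
      rw [a3, b3]
      exact hx.1 _ _ (a2.trans b2.symm) (hD.right_lt_left (a2.trans b2.symm) hz a4 b4 hc.le)
  · left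
    rw [← a2] at h3 h4
    rw [a3, ← a2]
    rcases hD.col_lt_or_lt h' h3 h4 with h5 | h5
    · omega
    · exact hx.2.2.1 _ _ _ h' h3 h4 h5
  · left
    rw [← b2] at h1 h2
    rw [b3, ← b2]
    rcases hD.col_lt_or_lt h h1 h2 with h5 | h5
    · exact hx.2.1 _ _ _ h h1 h2 h5
    · omega
  · exact .inl (hx.2.2.2 _ _ _ _ _ h h' h1 h2 h3 h4 hc)

/-- Two edges that are straightened faithfully meet in common ends only. -/
theorem Faithful.common_end (hD : D.IsPlanar) {x : V → ℝ} (hx : D.Faithful x)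
    {u v u' v' : V} (h : G.Adj u v) (h' : G.Adj u' v') (hne : s(u, v) ≠ s(u', v'))
    (hr : D.row u < D.row v) (hr' : D.row u' < D.row v')
    (hlt : max (D.row u) (D.row u') < min (D.row v) (D.row v')) {y : ℝ}
    (h1 : D.row u ≤ y) (h2 : y ≤ D.row v) (h3 : D.row u' ≤ y) (h4 : y ≤ D.row v')
    (he : crossing x D.row u v y = crossing x D.row u' v' y) :
    ∃ z, z ∈ s(u, v) ∧ z ∈ s(u', v') ∧ y = D.row z ∧ crossing x D.row u v y = x z := by
  rw [max_lt_iff, lt_min_iff, lt_min_iff] at hlt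
  have hcne := hD.col_ne h h' hne hr hlt.1.2 hlt.2.1 hr'
  wlog hc : D.col u v < D.col u' v' generalizing u v u' v'
  · obtain ⟨z, z1, z2, z3, z4⟩ := this h' h hne.symm hr' hr ⟨⟨hr', hlt.2.1⟩, hlt.1.2, hr⟩
      h3 h4 h1 h2 he.symm hcne.symm (by omega)
    exact ⟨z, z2, z1, z3, he.trans z4⟩
  -- The common vertical range runs from the row of `a` to the row of `b`. The edges are weakly
  -- ordered at both of these rows, so by affinity they can meet only at a row where equality holds.
  obtain ⟨a, ha, hau, hau', hmin⟩ : ∃ a, (a = u ∨ a = u') ∧ D.row u ≤ D.row a ∧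
      D.row u' ≤ D.row a ∧ (D.row a : ℝ) ≤ y := by
    rcases le_total (D.row u) (D.row u') with hh | hh
    · exact ⟨u', .inr rfl, hh, le_rfl, h3⟩
    · exact ⟨u, .inl rfl, le_rfl, hh, h1⟩
  obtain ⟨b, hb, hbv, hbv', hmax⟩ : ∃ b, (b = v ∨ b = v') ∧ D.row b ≤ D.row v ∧
      D.row b ≤ D.row v' ∧ y ≤ D.row b := by
    rcases le_total (D.row v) (D.row v') with hh | hh
    · exact ⟨v, .inl rfl, le_rfl, hh, h2⟩
    · exact ⟨v', .inr rfl, hh, le_rfl, h4⟩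
  have hab : D.row a < D.row b := by
    rcases ha with rfl | rfl <;> rcases hb with rfl | rfl <;> omega
  have hab' : (D.row a : ℝ) < D.row b := by exact_mod_cast hab
  have ca := hx.crossing_lt_or hD (w := a) h h' hr hr' hau (by omega) hau' (by omega) hc
  have cb := hx.crossing_lt_or hD (w := b) h h' hr hr' (by omega) hbv (by omega) hbv' hc
  obtain ⟨α, β, hα⟩ := crossing_affine x D.row u v
  obtain ⟨α', β', hα'⟩ := crossing_affine x D.row u' v'
  have hy := he
  rw [hα, hα'] at hy
  rcases ca with ca | ⟨z, z1, z2, z3, z4, z5⟩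
  · rcases cb with cb | ⟨z', z1', z2', z3', z4', z5'⟩
    · rw [hα, hα'] at ca cb
      rcases le_total β β' with hβ | hβ <;> nlinarith
    · suffices y = D.row b by
        subst this
        exact ⟨z', z1', z2', by rw [z3'], z4'⟩
      have e := z4'.trans z5'.symm
      rw [hα, hα'] at ca e
      by_contra hyb
      have hyb : y < D.row b := lt_of_le_of_ne hmax hyb
      nlinarith
  · rcases cb with cb | ⟨z', z1', z2', z3', z4', z5'⟩
    · suffices y = D.row a by
        subst this
        exact ⟨z, z1, z2, by rw [z3], z4⟩
      have e := z4.trans z5.symm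
      rw [hα, hα'] at cb e
      by_contra hya
      have hya : (D.row a : ℝ) < y := lt_of_le_of_ne hmin (Ne.symm hya)
      nlinarith
    -- Sharing ends at both rows would make the two edges equal.
    · have hz : z ≠ z' := by rintro rfl; omega
      exact absurd (((Sym2.mem_and_mem_iff hz).1 ⟨z1, z1'⟩).trans
        ((Sym2.mem_and_mem_iff hz).1 ⟨z2, z2'⟩).symm) hne

/-- The straight-line drawing with the same rows and the given abscissas. -/
def straighten (D : FlatVisibilityRepresentation G) (X : V → ℤ) : StraightLineDrawing G :=
  ⟨fun v => (X v, D.row v)⟩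

theorem Faithful.isPlanar_straighten (hD : D.IsPlanar) {X : V → ℤ}
    (hX : D.Faithful fun v => (X v : ℝ)) : (D.straighten X).IsPlanar := by
  have hS : ∀ {u v}, D.row u < D.row v → ∀ z : ℝ × ℝ,
      z ∈ gridSegment (X u, D.row u) (X v, D.row v) ↔ (D.row u : ℝ) ≤ z.2 ∧ z.2 ≤ D.row v ∧
        z.1 = crossing (fun v => (X v : ℝ)) D.row u v z.2 :=
    fun h z => mem_gridSegment_of_lt h z
  have hH : ∀ {u v}, D.row u = D.row v → X u < X v → ∀ z : ℝ × ℝ,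
      z ∈ gridSegment (X u, D.row u) (X v, D.row v) ↔
        z.2 = D.row u ∧ (X u : ℝ) ≤ z.1 ∧ z.1 ≤ X v :=
    fun h h' z => mem_gridSegment_horizontal h h'.le z
  have pt : ∀ {z : ℝ × ℝ} {w}, z ∈ ({toPlane (X w, D.row w)} : Set (ℝ × ℝ)) ↔
      z.1 = X w ∧ z.2 = D.row w := by
    intro z w
    rw [Set.mem_singleton_iff, Prod.ext_iff]
    rfl
  have inj := hX.inj hD
  have gap : ∀ u v w, G.Adj u v → D.row u = D.row v → D.row w = D.row u → X u < X w →
      X w < X v → False := by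
    intro u v w h hr hw h1 h2
    exact hD.not_between h hr hw ((hX.lt_iff_of_flat hD hw.symm).1 h1)
      ((hX.lt_iff_of_flat hD (hw.trans hr)).1 h2)
  have sv : ∀ u v w, G.Adj u v → D.row u < D.row v →
      ∀ p ∈ gridSegment (X u, D.row u) (X v, D.row v),
        p ∈ ({toPlane (X w, D.row w)} : Set (ℝ × ℝ)) → w ∈ s(u, v) := by
    intro u v w h hr p hp hw
    obtain ⟨h1, h2, h3⟩ := (hS hr p).1 hp
    obtain ⟨h4, h5⟩ := pt.1 hw
    rw [h5] at h1 h2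
    rw [h4, h5] at h3
    rw [Int.cast_le] at h1 h2
    rcases h1.eq_or_lt with h1 | h1
    · rw [← h1, crossing_left] at h3
      rw [inj w u h1.symm (by exact_mod_cast h3)]
      simp
    rcases h2.eq_or_lt with h2 | h2
    · rw [h2, crossing_right _ _ hr] at h3
      rw [inj w v h2 (by exact_mod_cast h3)]
      simp
    exfalso
    rcases hD.col_lt_or_lt h h1 h2 with h6 | h6
    · exact (hX.2.1 _ _ _ h h1 h2 h6).ne' h3
    · exact (hX.2.2.1 _ _ _ h h1 h2 h6).ne h3
  have fv : ∀ u v w, G.Adj u v → (D.row u = D.row v ∧ X u < X v) →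
      ∀ p ∈ gridSegment (X u, D.row u) (X v, D.row v),
        p ∈ ({toPlane (X w, D.row w)} : Set (ℝ × ℝ)) → w ∈ s(u, v) := by
    rintro u v w h ⟨hr, hx⟩ p hp hw
    obtain ⟨h1, h2, h3⟩ := (hH hr hx p).1 hp
    obtain ⟨h4, h5⟩ := pt.1 hw
    rw [h5, Int.cast_inj] at h1
    rw [h4, Int.cast_le] at h2 h3
    rcases h2.eq_or_lt with h2 | h2
    · rw [inj u w h1.symm h2]; simp
    rcases h3.eq_or_lt with h3 | h3
    · rw [inj w v (h1.trans hr) h3]; simp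
    exact (gap u v w h hr h1 h2 h3).elim
  refine IsPlanarPicture.of_oriented (fun u v => D.row u < D.row v)
    (fun u v => D.row u = D.row v ∧ X u < X v) (fun _ _ => gridSegment_comm _ _) ?_ ?_ sv fv
    ?_ ?_ ?_
  · intro u v h
    rcases lt_trichotomy (D.row u) (D.row v) with hr | hr | hr
    · exact .inl (.inl hr)
    · rcases lt_trichotomy (X u) (X v) with hx | hx | hx
      · exact .inr (.inl ⟨hr, hx⟩)
      · exact absurd (inj u v hr hx) h.ne
      · exact .inr (.inr ⟨hr.symm, hx⟩)
    · exact .inl (.inr hr)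
  · intro u v hne
    rw [Set.disjoint_left]
    intro p hp hp'
    obtain ⟨h1, h2⟩ := pt.1 hp
    obtain ⟨h3, h4⟩ := pt.1 hp'
    exact hne (inj u v (by exact_mod_cast h2.symm.trans h4) (by exact_mod_cast h1.symm.trans h3))
  · intro u v u' v' h h' hr hr' hne p hp hp'
    obtain ⟨h1, h2, h3⟩ := (hS hr p).1 hp
    obtain ⟨h4, h5, h6⟩ := (hS hr' p).1 hp'
    by_cases hlt : max (D.row u) (D.row u') < min (D.row v) (D.row v')
    · obtain ⟨z, z1, z2, z3, z4⟩ := hX.common_end hD h h' hne hr hr' hlt h1 h2 h4 h5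
        (h3.symm.trans h6)
      exact ⟨z, z1, z2, pt.2 ⟨h3.trans z4, z3⟩⟩
    -- The vertical ranges touch in a single row, so the meeting point is the top of one edge and
    -- the bottom of the other.
    · have h7 : D.row u ≤ D.row v' := by exact_mod_cast h1.trans h5
      have h8 : D.row u' ≤ D.row v := by exact_mod_cast h4.trans h2
      have h9 : D.row v = D.row u' ∨ D.row v' = D.row u := by omega
      rcases h9 with h9 | h9
      · have hy : p.2 = D.row v := le_antisymm h2 (by rw [h9]; exact h4)
        have hpv : p ∈ ({toPlane (X v, D.row v)} : Set (ℝ × ℝ)) :=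
          pt.2 ⟨by rw [h3, hy, crossing_right _ _ hr], hy⟩
        exact ⟨v, by simp, sv _ _ _ h' hr' p hp' hpv, hpv⟩
      · have hy : p.2 = D.row v' := le_antisymm h5 (by rw [h9]; exact h1)
        have hpv : p ∈ ({toPlane (X v', D.row v')} : Set (ℝ × ℝ)) :=
          pt.2 ⟨by rw [h6, hy, crossing_right _ _ hr'], hy⟩
        exact ⟨v', sv _ _ _ h hr p hp hpv, by simp, hpv⟩
  · rintro u v u' v' h h' hr ⟨hr', hx'⟩ p hp hp'
    obtain ⟨h1, h2, h3⟩ := (hS hr p).1 hp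
    obtain ⟨h4, h5, h6⟩ := (hH hr' hx' p).1 hp'
    rw [h4] at h1 h2 h3
    rw [Int.cast_le] at h1 h2
    rcases h1.eq_or_lt with h1 | h1
    · have hpv : p ∈ ({toPlane (X u, D.row u)} : Set (ℝ × ℝ)) :=
        pt.2 ⟨by rw [h3, ← h1, crossing_left], by rw [h4, h1]⟩
      exact ⟨u, by simp, fv _ _ _ h' ⟨hr', hx'⟩ p hp' hpv, hpv⟩
    rcases h2.eq_or_lt with h2 | h2
    · have hpv : p ∈ ({toPlane (X v, D.row v)} : Set (ℝ × ℝ)) :=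
        pt.2 ⟨by rw [h3, h2, crossing_right _ _ hr], by rw [h4, h2]⟩
      exact ⟨v, by simp, fv _ _ _ h' ⟨hr', hx'⟩ p hp' hpv, hpv⟩
    exfalso
    -- Faithfulness is read backwards: a slanted edge meeting the flat one would also pass between
    -- the ends of the flat edge in `D`.
    have h7 : D.right u' < D.col u v := by
      refine (hD.col_lt_or_lt h h1 h2).resolve_left fun h7 => ?_
      exact (hX.2.1 _ _ _ h h1 h2 h7).not_ge (by rw [← h3]; exact h5)
    have h8 : D.col u v < D.left v' := by
      rw [hr'] at h1 h2 h3
      refine (hD.col_lt_or_lt h h1 h2).resolve_right fun h7 => ?_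
      exact (hX.2.2.1 _ _ _ h h1 h2 h7).not_ge (by rw [← h3]; exact h6)
    exact hD.not_col_between h' hr' h h1 h2 h7 h8
  · rintro u v u' v' h h' ⟨hr, hx⟩ ⟨hr', hx'⟩ hne p hp hp'
    obtain ⟨h1, h2, h3⟩ := (hH hr hx p).1 hp
    obtain ⟨h4, h5, h6⟩ := (hH hr' hx' p).1 hp'
    have hrr : D.row u = D.row u' := by exact_mod_cast h1.symm.trans h4
    rcases flat_edges_apart inj gap h h' hr hr' hrr hx hx' hne with h7 | h7
    · have h7' : (X v : ℝ) ≤ X u' := by exact_mod_cast h7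
      have hpv : p ∈ ({toPlane (X v, D.row v)} : Set (ℝ × ℝ)) :=
        pt.2 ⟨by linarith, by rw [h1, hr]⟩
      exact ⟨v, by simp, fv _ _ _ h' ⟨hr', hx'⟩ p hp' hpv, hpv⟩
    · have h7' : (X v' : ℝ) ≤ X u := by exact_mod_cast h7
      have hpv : p ∈ ({toPlane (X u, D.row u)} : Set (ℝ × ℝ)) :=
        pt.2 ⟨by linarith, h1⟩
      exact ⟨u, by simp, fv _ _ _ h' ⟨hr', hx'⟩ p hp' hpv, hpv⟩

end FlatVisibilityRepresentation

/-! ### The level grid of a representation, and faithful abscissas -/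

namespace FlatVisibilityRepresentation

variable {V : Type*} {G : SimpleGraph V} (D : FlatVisibilityRepresentation G)

/-- The point `x` of level `j` lies on the segment of `v`, if the rows of `D` are taken as every
third level. -/
def InBox (j x : ℤ) (v : V) : Prop := 3 * D.row v = j ∧ D.left v ≤ x ∧ x ≤ D.right v

/-- The point `x` of level `j` lies on the edge `uv`, strictly between its ends. -/
def OnEdge (j x : ℤ) (u v : V) : Prop :=
  G.Adj u v ∧ 3 * D.row u < j ∧ j < 3 * D.row v ∧ D.col u v = x

open Classical in
/-- The left end of the vertex segment through a point, or the point itself. -/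
noncomputable def boxLeft (j x : ℤ) : ℤ :=
  if h : ∃ v, D.InBox j x v then D.left h.choose else x

open Classical in
/-- The right end of the vertex segment through a point, or the point itself. -/
noncomputable def boxRight (j x : ℤ) : ℤ :=
  if h : ∃ v, D.InBox j x v then D.right h.choose else x

variable {D}

theorem box_of_not {j x : ℤ} (h : ¬ ∃ v, D.InBox j x v) :
    D.boxLeft j x = x ∧ D.boxRight j x = x :=
  ⟨dif_neg h, dif_neg h⟩

variable (hD : D.IsPlanar)
include hD

theorem IsPlanar.inBox_unique {j x : ℤ} {v w : V} (hv : D.InBox j x v) (hw : D.InBox j x w) :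
    v = w :=
  hD.eq_of_mem (by have := hv.1; have := hw.1; omega) hv.2 hw.2

theorem IsPlanar.box_eq {j x : ℤ} {v : V} (h : D.InBox j x v) :
    D.boxLeft j x = D.left v ∧ D.boxRight j x = D.right v := by
  have hex : ∃ v, D.InBox j x v := ⟨v, h⟩
  have e := hD.inBox_unique hex.choose_spec h
  exact ⟨by rw [boxLeft, dif_pos hex, e], by rw [boxRight, dif_pos hex, e]⟩

theorem IsPlanar.not_onEdge {j x : ℤ} {u v w : V} (h : D.InBox j x w) :
    ¬ D.OnEdge j x u v := by
  rintro ⟨h1, h2, h3, h4⟩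
  obtain ⟨h5, h6, h7⟩ := h
  rcases hD.col_lt_or_lt (w := w) h1 (by omega) (by omega) with h8 | h8 <;> omega

/-- The left end of a segment belongs to the segment, so by disjointness it identifies the segment,
and it cannot be a free point. -/
theorem IsPlanar.inBox_of_boxLeft_eq {j p q : ℤ} {v : V} (hp : D.InBox j p v)
    (h : D.boxLeft j p = D.boxLeft j q) : D.InBox j q v := by
  rw [(hD.box_eq hp).1] at h
  have := D.left_le_right v
  obtain ⟨hp1, hp2, hp3⟩ := hp
  by_cases hq : ∃ w, D.InBox j q w
  · obtain ⟨w, hw⟩ := hq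
    rw [(hD.box_eq hw).1] at h
    have := D.left_le_right w
    have hw1 := hw.1
    obtain rfl := hD.eq_of_mem (v := v) (w := w) (c := D.left v) (by omega) (by omega) (by omega)
    exact hw
  · rw [(box_of_not hq).1] at h
    exact ⟨hp1, by omega, by omega⟩

/-- The grid of a planar flat visibility representation which lies strictly between the
columns `A` and `B`. -/
noncomputable def IsPlanar.levelGrid (A B : ℤ) (hAB : A < B) (hA : ∀ v, A < D.left v)
    (hB : ∀ v, D.right v < B) : LevelGrid where
  A := A
  B := B
  A_lt_B := hAB
  lo := D.boxLeft
  hi := D.boxRight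
  rigid j x := x ≤ A ∨ B ≤ x ∨ ∃ u v, D.OnEdge j x u v
  lo_le j x := by
    by_cases h : ∃ v, D.InBox j x v
    · obtain ⟨v, hv⟩ := h
      rw [(hD.box_eq hv).1]; exact hv.2.1
    · rw [(box_of_not h).1]
  le_hi j x := by
    by_cases h : ∃ v, D.InBox j x v
    · obtain ⟨v, hv⟩ := h
      rw [(hD.box_eq hv).2]; exact hv.2.2
    · rw [(box_of_not h).2]
  sep j x x' hx := by
    by_cases h : ∃ v, D.InBox j x v <;> by_cases h' : ∃ v, D.InBox j x' v
    · obtain ⟨v, hv⟩ := h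
      obtain ⟨w, hw⟩ := h'
      rw [(hD.box_eq hv).1, (hD.box_eq hv).2, (hD.box_eq hw).1, (hD.box_eq hw).2]
      by_cases hvw : v = w
      · rw [hvw]; exact .inr ⟨rfl, rfl⟩
      · exact .inl (hD.right_lt_left (by have := hv.1; have := hw.1; omega) hvw hv.2 hw.2 hx.le)
    · obtain ⟨v, hv⟩ := h
      rw [(hD.box_eq hv).2, (box_of_not h').1]
      left
      by_contra hlt
      exact h' ⟨v, hv.1, hv.2.1.trans hx.le, not_lt.1 hlt⟩
    · obtain ⟨v, hv⟩ := h'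
      rw [(hD.box_eq hv).1, (box_of_not h).2]
      left
      by_contra hlt
      exact h ⟨v, hv.1, not_lt.1 hlt, hx.le.trans hv.2.2⟩
    · rw [(box_of_not h).2, (box_of_not h').1]
      exact .inl hx
  rigid_eq j x hr := by
    refine box_of_not ?_
    rintro ⟨v, hv⟩
    have h1 := hA v
    have h2 := hB v
    obtain ⟨-, h3, h4⟩ := id hv
    rcases hr with hr | hr | ⟨u, w, hr⟩
    · omega
    · omega
    · exact hD.not_onEdge hv hr
  rigid_left j x h := .inl h
  rigid_right j x h := .inr (.inl h)

/-- A property that passes from level to level along the edge `uv` in column `p`, until `p` and `q`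
get into the same box, holds on the whole edge, and its ends extend to the column `q`. -/
theorem IsPlanar.along_edge {T : ℤ → Prop} {p q : ℤ} (hne : p ≠ q)
    (hT : ∀ j v, T j → ¬ D.InBox j p v)
    (up : ∀ j, T j → T (j + 1) ∨ D.boxLeft (j + 1) p = D.boxLeft (j + 1) q)
    (down : ∀ j, T j → T (j - 1) ∨ D.boxLeft (j - 1) p = D.boxLeft (j - 1) q)
    {j : ℤ} {u v : V} (hj : T j) (h : D.OnEdge j p u v) :
    (∀ k, 3 * D.row u < k → k < 3 * D.row v → T k) ∧
      D.InBox (3 * D.row v) q v ∧ D.InBox (3 * D.row u) q u := by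
  obtain ⟨hadj, h1, h2, hcol⟩ := h
  -- Strictly inside the edge, column `p` lies in no box, so the second alternative of `up` and
  -- `down` is excluded.
  have hfree : ∀ k, 3 * D.row u < k → k < 3 * D.row v → D.boxLeft k p ≠ D.boxLeft k q := by
    intro k hk1 hk2 he
    have hp : ¬ ∃ w, D.InBox k p w := fun ⟨w, hw⟩ => hD.not_onEdge hw ⟨hadj, hk1, hk2, hcol⟩
    by_cases hq : ∃ w, D.InBox k q w
    · obtain ⟨w, hw⟩ := hq
      exact hp ⟨w, hD.inBox_of_boxLeft_eq hw he.symm⟩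
    · rw [(box_of_not hp).1, (box_of_not hq).1] at he
      exact hne he
  have hup : ∀ n : ℕ, j + n < 3 * D.row v → T (j + n) := by
    intro n
    induction n with
    | zero => intro _; simpa using hj
    | succ n ih =>
      intro hn
      push_cast at hn ⊢
      rw [← add_assoc]
      exact (up _ (ih (by omega))).resolve_right (hfree _ (by omega) (by omega))
  have hdown : ∀ n : ℕ, 3 * D.row u < j - n → T (j - n) := by
    intro n
    induction n with
    | zero => intro _; simpa using hj
    | succ n ih =>
      intro hn
      push_cast at hn ⊢
      rw [← sub_sub]
      exact (down _ (ih (by omega))).resolve_right (hfree _ (by omega) (by omega))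
  have hall : ∀ k, 3 * D.row u < k → k < 3 * D.row v → T k := by
    intro k hk1 hk2
    rcases le_total j k with hjk | hjk
    · obtain ⟨n, rfl⟩ := Int.le.dest hjk
      exact hup n hk2
    · obtain ⟨n, hn⟩ := Int.le.dest hjk
      obtain rfl : k = j - n := by omega
      exact hdown n hk1
  have hr : D.row u ≠ D.row v := by omega
  have hpv : D.InBox (3 * D.row v) p v := by
    have := D.col_mem_right hadj hr
    rw [hcol] at this
    exact ⟨rfl, this⟩
  have hpu : D.InBox (3 * D.row u) p u := by
    have := (D.attach_mem hadj).2
    rw [hcol] at this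
    exact ⟨rfl, this⟩
  refine ⟨hall, hD.inBox_of_boxLeft_eq hpv ?_, hD.inBox_of_boxLeft_eq hpu ?_⟩
  · have := up _ (hall (3 * D.row v - 1) (by omega) (by omega))
    rw [sub_add_cancel] at this
    exact this.resolve_left fun hT' => hT _ _ hT' hpv
  · have := down _ (hall (3 * D.row u + 1) (by omega) (by omega))
    rw [add_sub_cancel_right] at this
    exact this.resolve_left fun hT' => hT _ _ hT' hpu

/-- If `T` held somewhere, it would spread along an edge in column `p` and an edge in column `q` up
to the same two boxes. The two edges would have the same ends, hence the same column. -/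
theorem IsPlanar.noparallel {T : ℤ → Prop} {p q A B : ℤ} (hne : p < q) (hp : A ≤ p) (hq : q ≤ B)
    (hA : ∀ v, A < D.left v) (hB : ∀ v, D.right v < B) (hAB : A < p ∨ q < B)
    (rigp : ∀ j, T j → p ≤ A ∨ B ≤ p ∨ ∃ u v, D.OnEdge j p u v)
    (rigq : ∀ j, T j → q ≤ A ∨ B ≤ q ∨ ∃ u v, D.OnEdge j q u v)
    (up : ∀ j, T j → T (j + 1) ∨ D.boxLeft (j + 1) p = D.boxLeft (j + 1) q)
    (down : ∀ j, T j → T (j - 1) ∨ D.boxLeft (j - 1) p = D.boxLeft (j - 1) q) (j : ℤ) :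
    ¬ T j := by
  intro hj
  have bounds : ∀ {j x v}, D.InBox j x v → A < x ∧ x < B := by
    intro j x v h
    have := hA v
    have := hB v
    obtain ⟨-, h1, h2⟩ := h
    omega
  have hTp : ∀ j v, T j → ¬ D.InBox j p v := by
    intro j v hT hv
    have := bounds hv
    rcases rigp j hT with hr | hr | ⟨u, w, hr⟩
    · omega
    · omega
    · exact hD.not_onEdge hv hr
  have hTq : ∀ j v, T j → ¬ D.InBox j q v := by
    intro j v hT hv
    have := bounds hv
    rcases rigq j hT with hr | hr | ⟨u, w, hr⟩
    · omega
    · omega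
    · exact hD.not_onEdge hv hr
  have alongp := @IsPlanar.along_edge _ _ _ hD T p q hne.ne hTp up down j
  have alongq := @IsPlanar.along_edge _ _ _ hD T q p hne.ne' hTq
    (fun j hj => (up j hj).imp_right Eq.symm) (fun j hj => (down j hj).imp_right Eq.symm) j
  -- A column inside the walls is rigid only because of an edge. The ends of that edge also contain
  -- the other column, which is therefore inside the walls as well.
  have hin : A < p ∧ q < B := by
    rcases hAB with h | h
    · rcases rigp j hj with hr | hr | ⟨u, v, hr⟩
      · omega
      · omega
      · exact ⟨h, (bounds (alongp hj hr).2.1).2⟩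
    · rcases rigq j hj with hr | hr | ⟨u, v, hr⟩
      · omega
      · omega
      · exact ⟨(bounds (alongq hj hr).2.1).1, h⟩
  obtain ⟨u, v, he⟩ := ((rigp j hj).resolve_left (by omega)).resolve_left (by omega)
  obtain ⟨u', v', he'⟩ := ((rigq j hj).resolve_left (by omega)).resolve_left (by omega)
  obtain ⟨a1, a2, a3⟩ := alongp hj he
  obtain ⟨b1, b2, b3⟩ := alongq hj he'
  obtain ⟨hadj, h1, h2, hcol⟩ := he
  obtain ⟨hadj', h1', h2', hcol'⟩ := he'
  have hr' : D.row u' ≠ D.row v' := by omega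
  have hqv' : D.InBox (3 * D.row v') q v' := by
    have := D.col_mem_right hadj' hr'
    rw [hcol'] at this
    exact ⟨rfl, this⟩
  have hqu' : D.InBox (3 * D.row u') q u' := by
    have := (D.attach_mem hadj').2
    rw [hcol'] at this
    exact ⟨rfl, this⟩
  -- If one edge ended earlier, its end box would lie at a level where `T` still holds along the
  -- other edge.
  have hv : D.row v = D.row v' := by
    rcases lt_trichotomy (D.row v) (D.row v') with h | h | h
    · exact absurd a2 (hTq _ _ (b1 _ (by omega) (by omega)))
    · exact h
    · exact absurd hqv' (hTq _ _ (a1 _ (by omega) (by omega)))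
  have hu : D.row u = D.row u' := by
    rcases lt_trichotomy (D.row u) (D.row u') with h | h | h
    · exact absurd hqu' (hTq _ _ (a1 _ (by omega) (by omega)))
    · exact h
    · exact absurd a3 (hTq _ _ (b1 _ (by omega) (by omega)))
  rw [hv] at a2
  rw [hu] at a3
  obtain rfl := hD.inBox_unique a2 hqv'
  obtain rfl := hD.inBox_unique a3 hqu'
  omega

theorem IsPlanar.exists_faithful [Finite V] : ∃ x : V → ℝ, D.Faithful x := by
  obtain ⟨A, B, hAB, hA', hB'⟩ : ∃ A B : ℤ, A < B ∧ (∀ v, A < D.left v) ∧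
      ∀ v, D.right v < B := by
    obtain ⟨A, hA⟩ := (Set.finite_range D.left).bddBelow
    obtain ⟨B, hB⟩ := (Set.finite_range D.right).bddAbove
    -- The maximum keeps the walls apart even when there are no vertices and the bounds are
    -- arbitrary.
    refine ⟨A - 1, max A (B + 1), by omega, fun v => ?_, fun v => ?_⟩
    · have := hA ⟨v, rfl⟩
      omega
    · have := hB ⟨v, rfl⟩
      omega
  let Γ := hD.levelGrid A B hAB hA' hB'
  obtain ⟨F, hF, hF0, hF1, hav⟩ := Γ.exists_harmonic
  have hlo : ∀ {j x v}, D.InBox j x v → Γ.lo j x = D.left v := fun h => (hD.box_eq h).1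
  have strict : ∀ {j p q}, A ≤ p → q ≤ B → p < q → Γ.lo j p ≠ Γ.lo j q → F j p < F j q := by
    intro j p q
    refine LevelGrid.strict_of_harmonic hF hF0 hF1 hav ?_ ?_
    · intro j
      -- Rows are placed at multiples of 3 for this: `j + 1` and `j - 1` differ by 2, so they are
      -- not both rows.
      have : (∀ v, 3 * D.row v ≠ j + 1) ∨ ∀ v, 3 * D.row v ≠ j - 1 := by
        by_contra hcon
        push Not at hcon
        obtain ⟨⟨v, hv⟩, w, hw⟩ := hcon
        omega
      exact this.imp (fun h x => (box_of_not fun ⟨v, hv⟩ => h v hv.1).1)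
        fun h x => (box_of_not fun ⟨v, hv⟩ => h v hv.1).1
    · intro p q hpq hp hq hor T hT up down
      exact hD.noparallel hpq hp hq hA' hB' hor (fun j hj => (hT j hj).1)
        (fun j hj => (hT j hj).2) up down
  have inleft : ∀ v, D.InBox (3 * D.row v) (D.left v) v :=
    fun v => ⟨rfl, le_rfl, D.left_le_right v⟩
  -- Inside the edge its column is rigid, so `F` is affine along it; at its ends `F` has the values
  -- of the two vertex segments.
  have cross : ∀ {j u v}, G.Adj u v → 3 * D.row u < j → j < 3 * D.row v →
      F j (D.col u v) = F (3 * D.row u) (D.left u) +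
        (F (3 * D.row v) (D.left v) - F (3 * D.row u) (D.left u)) *
          ((j - (3 * D.row u : ℤ) : ℝ) / ((3 * D.row v : ℤ) - (3 * D.row u : ℤ))) := by
    intro j u v h h1 h2
    have hu : D.InBox (3 * D.row u) (D.col u v) u := ⟨rfl, (D.attach_mem h).2⟩
    have hv : D.InBox (3 * D.row v) (D.col u v) v := ⟨rfl, D.col_mem_right h (by omega)⟩
    rw [LevelGrid.eq_of_lo_eq hav ((hlo (inleft u)).trans (hlo hu).symm),
      LevelGrid.eq_of_lo_eq hav ((hlo (inleft v)).trans (hlo hv).symm)]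
    refine eq_affine_of_eq_average (g := fun j => F j (D.col u v)) (fun k hk1 hk2 => ?_) h1 h2
    have hr : Γ.rigid k (D.col u v) := .inr (.inr ⟨u, v, h, hk1, hk2, rfl⟩)
    exact (hav _ _).trans (Γ.average_of_rigid F hr)
  have cross' : ∀ {w u v}, G.Adj u v → D.row u < D.row w → D.row w < D.row v →
      crossing (fun v => F (3 * D.row v) (D.left v)) D.row u v (D.row w) =
        F (3 * D.row w) (D.col u v) := by
    intro w u v h h1 h2
    rw [cross h (by omega) (by omega), crossing]
    push_cast
    rw [← mul_sub, ← mul_sub, mul_div_mul_left _ _ (by norm_num)]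
  have hloedge : ∀ {w u v}, G.Adj u v → D.row u < D.row w → D.row w < D.row v →
      Γ.lo (3 * D.row w) (D.col u v) = D.col u v := fun h h1 h2 =>
    (Γ.rigid_eq _ _ (.inr (.inr ⟨_, _, h, by omega, by omega, rfl⟩))).1
  have colbd : ∀ {u v}, G.Adj u v → A ≤ D.col u v ∧ D.col u v ≤ B := fun {u v} h => by
    have h1 := hA' u
    have h2 := hB' u
    have h3 := D.attach_mem h
    omega
  have boxbd : ∀ v, A ≤ D.left v ∧ D.right v ≤ B := fun v => ⟨(hA' v).le, (hB' v).le⟩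
  refine ⟨fun v => F (3 * D.row v) (D.left v), ?_, ?_, ?_, ?_⟩
  · intro w w' hr h
    have h1 := inleft w'
    rw [← hr] at h1
    have h2 := D.left_le_right w
    have h3 := D.left_le_right w'
    simp only [← hr]
    refine strict (boxbd w).1 (h3.trans (boxbd w').2) (by omega) ?_
    rw [hlo (inleft w), hlo h1]
    omega
  · intro u v w h h1 h2 h3
    rw [cross' h h1 h2]
    refine strict (colbd h).1 ((D.left_le_right w).trans (boxbd w).2) h3 ?_
    rw [hloedge h h1 h2, hlo (inleft w)]
    omega
  · intro u v w h h1 h2 h3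
    rw [cross' h h1 h2]
    have h4 := D.left_le_right w
    refine strict (boxbd w).1 (colbd h).2 (by omega) ?_
    rw [hloedge h h1 h2, hlo (inleft w)]
    omega
  · intro u v u' v' w h h' h1 h2 h3 h4 h5
    rw [cross' h h1 h2, cross' h' h3 h4]
    refine strict (colbd h).1 (colbd h').2 h5 ?_
    rw [hloedge h h1 h2, hloedge h' h3 h4]
    omega

theorem IsPlanar.exists_straightLineDrawing [Finite V] :
    ∃ D' : StraightLineDrawing G, D'.IsPlanar ∧ ∀ v, D.row v = (D'.pos v).2 := by
  obtain ⟨x, hx⟩ := hD.exists_faithful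
  obtain ⟨X, hX⟩ := D.exists_int_faithful hx
  exact ⟨D.straighten X, hX.isPlanar_straighten hD, fun _ => rfl⟩

end FlatVisibilityRepresentation

/-! ### Ranking a relation that is only partly transitive -/

/-- A relation on a finite type has a compatible ranking, if it is asymmetric and transitive at
those elements which are lowest in a triple. -/
theorem exists_ranking {O : Type*} [Finite O] (R : O → O → Prop) (top : O → ℤ)
    (asymm : ∀ a b, R a b → ¬ R b a)
    (trans : ∀ a b c, R a b → R b c → top b ≤ top a → top b ≤ top c → R a c) :
    ∃ g : O → ℤ, ∀ a b, R a b → g a < g b := by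
  classical
  cases nonempty_fintype O
  have key : ∃ f : O → ℚ, ∀ a ∈ Finset.univ, ∀ b ∈ Finset.univ, R a b → f a < f b := by
    refine Finset.induction_on_min_value (motive := fun S : Finset O =>
      ∃ f : O → ℚ, ∀ a ∈ S, ∀ b ∈ S, R a b → f a < f b) top Finset.univ ⟨0, by simp⟩ ?_
    rintro b S hb hmin ⟨f, hf⟩
    -- Elements are inserted by decreasing `top`. The new `b` is the lowest so far, so transitivity
    -- at `b` puts the values of its predecessors below those of its successors, and density of `ℚ`
    -- leaves room for a value between them.
    obtain ⟨m, hm1, hm2⟩ := Order.exists_between_finsets ((S.filter (R · b)).image f)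
      ((S.filter (R b ·)).image f) (by
        intro x hx y hy
        obtain ⟨a, ha, rfl⟩ := Finset.mem_image.1 hx
        obtain ⟨c, hc, rfl⟩ := Finset.mem_image.1 hy
        obtain ⟨ha, hab⟩ := Finset.mem_filter.1 ha
        obtain ⟨hc, hbc⟩ := Finset.mem_filter.1 hc
        exact hf a ha c hc (trans a b c hab hbc (hmin a ha) (hmin c hc)))
    have hne : ∀ a ∈ S, a ≠ b := fun a ha e => hb (e ▸ ha)
    refine ⟨Function.update f b m, ?_⟩
    intro a ha c hc hac
    rw [Finset.mem_insert] at ha hc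
    rcases ha with ha | ha <;> rcases hc with hc | hc
    · rw [ha, hc] at hac
      exact absurd hac (asymm _ _ hac)
    · rw [ha, Function.update_self, Function.update_of_ne (hne c hc)]
      rw [ha] at hac
      exact hm2 _ (Finset.mem_image_of_mem _ (Finset.mem_filter.2 ⟨hc, hac⟩))
    · rw [hc, Function.update_self, Function.update_of_ne (hne a ha)]
      rw [hc] at hac
      exact hm1 _ (Finset.mem_image_of_mem _ (Finset.mem_filter.2 ⟨ha, hac⟩))
    · rw [Function.update_of_ne (hne a ha), Function.update_of_ne (hne c hc)]
      exact hf a ha c hc hac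
  obtain ⟨f, hf⟩ := key
  -- Counting the smaller values turns rational values into integers.
  refine ⟨fun a => ((Finset.univ.filter fun c => f c < f a).card : ℤ), fun a b hab => ?_⟩
  have hlt := hf a (Finset.mem_univ _) b (Finset.mem_univ _) hab
  rw [Int.ofNat_lt]
  refine Finset.card_lt_card ⟨fun c hc => ?_, fun hsub => ?_⟩
  · simp only [Finset.mem_filter, Finset.mem_univ, true_and] at hc ⊢
    exact hc.trans hlt
  · have := hsub (Finset.mem_filter.2 ⟨Finset.mem_univ a, hlt⟩)
    simp at this

/-! ### Left-to-right order of the objects in a straight-line drawing -/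

namespace StraightLineDrawing

variable {V : Type*} {G : SimpleGraph V} (D : StraightLineDrawing G)

/-- The row of a vertex. -/
def row (v : V) : ℤ := (D.pos v).2

/-- The abscissa of a vertex. -/
def abscissa (v : V) : ℝ := (D.pos v).1

/-- The pairs `(v, v)` stand for the vertices, the pairs `(u, v)` with `u` below `v` for the edges
that are not horizontal. -/
def IsObject (a : V × V) : Prop := a.1 = a.2 ∨ G.Adj a.1 a.2 ∧ D.row a.1 < D.row a.2

/-- The abscissa of an object at height `y`. -/
noncomputable def abscissaAt (a : V × V) (y : ℝ) : ℝ := crossing D.abscissa D.row a.1 a.2 y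

/-- The height `y` lies in the range of the object `a`. -/
def Reaches (a : V × V) (y : ℝ) : Prop := D.row a.1 ≤ y ∧ y ≤ D.row a.2

/-- At some height, the object `a` is to the left of the object `b`. -/
def LeftOf (a b : V × V) : Prop :=
  D.IsObject a ∧ D.IsObject b ∧
    ∃ y, D.Reaches a y ∧ D.Reaches b y ∧ D.abscissaAt a y < D.abscissaAt b y

variable {D}

theorem IsObject.mem_gridSegment {a : V × V} (ha : D.IsObject a) {y : ℝ} (hy : D.Reaches a y) :
    (D.abscissaAt a y, y) ∈ gridSegment (D.pos a.1) (D.pos a.2) := by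
  rcases ha with ha | ⟨-, ha⟩
  · obtain ⟨u, v⟩ := a
    obtain rfl : u = v := ha
    have : y = D.row u := le_antisymm hy.2 hy.1
    rw [gridSegment, segment_same, abscissaAt, crossing_self, this]
    rfl
  · exact (mem_gridSegment_of_lt ha _).2 ⟨hy.1, hy.2, rfl⟩

theorem IsObject.row_le {a : V × V} (ha : D.IsObject a) : D.row a.1 ≤ D.row a.2 := by
  rcases ha with ha | ⟨-, ha⟩
  · rw [ha]
  · exact ha.le

theorem IsObject.reaches {a : V × V} (ha : D.IsObject a) {z : V} (hz : z = a.1 ∨ z = a.2) :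
    D.Reaches a (D.row z) := by
  have h : (D.row a.1 : ℝ) ≤ D.row a.2 := by exact_mod_cast ha.row_le
  rcases hz with rfl | rfl
  · exact ⟨le_rfl, h⟩
  · exact ⟨h, le_rfl⟩

theorem IsObject.at_row {a : V × V} (ha : D.IsObject a) {z : V} (hz : z = a.1 ∨ z = a.2) :
    D.abscissaAt a (D.row z) = D.abscissa z := by
  rcases hz with rfl | rfl
  · exact crossing_left _ _ _ _
  · rcases ha with ha | ⟨-, ha⟩
    · rw [abscissaAt, ha, crossing_self]
    · exact crossing_right _ _ ha

theorem isObject_diag (v : V) : D.IsObject (v, v) := .inl rfl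

variable (hD : D.IsPlanar)
include hD

theorem IsPlanar.pos_inj {u v : V} (h : D.pos u = D.pos v) : u = v := by
  by_contra hne
  exact Set.disjoint_left.1 (hD.vertex_vertex u v hne) (Set.mem_singleton (toPlane (D.pos u)))
    (by rw [h]; rfl)

/-- Two objects meet in common ends only. -/
theorem IsPlanar.meet {a b : V × V} (ha : D.IsObject a) (hb : D.IsObject b) (hne : a ≠ b) {y : ℝ}
    (hay : D.Reaches a y) (hby : D.Reaches b y) (h : D.abscissaAt a y = D.abscissaAt b y) :
    ∃ z, (z = a.1 ∨ z = a.2) ∧ (z = b.1 ∨ z = b.2) ∧ y = D.row z := by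
  have hpa := ha.mem_gridSegment hay
  have hpb := hb.mem_gridSegment hby
  rw [← h] at hpb
  have vertex : ∀ {c : V × V}, c.1 = c.2 → ∀ {p},
      p ∈ gridSegment (D.pos c.1) (D.pos c.2) → p = toPlane (D.pos c.1) := by
    intro c hc p hp
    rw [← hc, gridSegment, segment_same] at hp
    exact hp
  rcases ha with ha | ⟨ha, har⟩ <;> rcases hb with hb | ⟨hb, hbr⟩
  · exfalso
    have e : D.pos a.1 = D.pos b.1 := by
      have := (vertex ha hpa).symm.trans (vertex hb hpb)
      rw [toPlane, toPlane, Prod.mk_inj] at this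
      exact Prod.ext (by exact_mod_cast this.1) (by exact_mod_cast this.2)
    have := hD.pos_inj e
    exact hne (Prod.ext this (ha.symm.trans (this.trans hb)))
  · have hv := vertex ha hpa
    refine ⟨a.1, .inl rfl, ?_, congrArg Prod.snd hv⟩
    by_contra hcon
    push Not at hcon
    exact Set.disjoint_left.1 (hD.edge_vertex _ _ _ hb hcon.1 hcon.2) hpb hv
  · have hv := vertex hb hpb
    refine ⟨b.1, ?_, .inl rfl, congrArg Prod.snd hv⟩
    by_contra hcon
    push Not at hcon
    exact Set.disjoint_left.1 (hD.edge_vertex _ _ _ ha hcon.1 hcon.2) hpa hv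
  · obtain ⟨z, hz1, hz2, hz3⟩ := hD.edge_edge _ _ _ _ ha hb (fun e => by
      rcases Sym2.eq_iff.1 e with ⟨e1, e2⟩ | ⟨e1, e2⟩
      · exact hne (Prod.ext e1 e2)
      · rw [e1, e2] at har; exact har.not_gt hbr) _ ⟨hpa, hpb⟩
    exact ⟨z, Sym2.mem_iff.1 hz1, Sym2.mem_iff.1 hz2, congrArg Prod.snd hz3⟩

/-- Objects in opposite orders at two heights would cross at a height strictly between, hence
strictly inside `a`, whereas they may meet only at common ends. -/
theorem IsPlanar.leftOf_asymm {a b : V × V} (h : D.LeftOf a b) : ¬ D.LeftOf b a := by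
  rintro ⟨-, -, y', hb', ha', h'⟩
  obtain ⟨ha, hb, y, hay, hby, hlt⟩ := h
  have hne : a ≠ b := by rintro rfl; exact hlt.false
  obtain ⟨α, β, hα⟩ := crossing_affine D.abscissa D.row a.1 a.2
  obtain ⟨α', β', hα'⟩ := crossing_affine D.abscissa D.row b.1 b.2
  simp only [abscissaAt, hα, hα'] at hlt h'
  have hβ : β ≠ β' := by rintro rfl; linarith
  have hβ' : β - β' ≠ 0 := sub_ne_zero.2 hβ
  -- the two lines meet at height `t`, strictly between `y` and `y'`
  let t := (α' - α) / (β - β')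
  have ht : (β - β') * t = α' - α := mul_div_cancel₀ _ hβ'
  have hb1 : (y < t ∧ t < y') ∨ (y' < t ∧ t < y) := by
    rcases lt_or_gt_of_ne hβ' with hs | hs
    · exact .inr ⟨by nlinarith, by nlinarith⟩
    · exact .inl ⟨by nlinarith, by nlinarith⟩
  have ha1 : D.row a.1 < t ∧ t < D.row a.2 := by
    rcases hb1 with h1 | h1
    · exact ⟨hay.1.trans_lt h1.1, h1.2.trans_le ha'.2⟩
    · exact ⟨ha'.1.trans_lt h1.1, h1.2.trans_le hay.2⟩
  have hb2 : D.Reaches b t := by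
    rcases hb1 with h1 | h1
    · exact ⟨hby.1.trans h1.1.le, h1.2.le.trans hb'.2⟩
    · exact ⟨hb'.1.trans h1.1.le, h1.2.le.trans hby.2⟩
  obtain ⟨z, hz, -, hz'⟩ := hD.meet ha hb hne ⟨ha1.1.le, ha1.2.le⟩ hb2 (by
    simp only [abscissaAt, hα, hα']; linarith)
  rcases hz with rfl | rfl
  · exact ha1.1.ne' hz'
  · exact ha1.2.ne hz'

theorem IsPlanar.at_le_of_leftOf {a b : V × V} (h : D.LeftOf a b) {y : ℝ} (ha : D.Reaches a y)
    (hb : D.Reaches b y) : D.abscissaAt a y ≤ D.abscissaAt b y :=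
  not_lt.1 fun hlt => hD.leftOf_asymm h ⟨h.2.1, h.1, y, hb, ha, hlt⟩

/-- All three objects reach the top of `b`, where they are weakly ordered. If `a` and `c` agree
there, all three meet at that point; their slopes are then strictly ordered, which separates them
below it. -/
theorem IsPlanar.leftOf_trans {a b c : V × V} (hab : D.LeftOf a b) (hbc : D.LeftOf b c)
    (hta : D.row b.2 ≤ D.row a.2) (htc : D.row b.2 ≤ D.row c.2) : D.LeftOf a c := by
  have hta' : (D.row b.2 : ℝ) ≤ D.row a.2 := by exact_mod_cast hta
  have htc' : (D.row b.2 : ℝ) ≤ D.row c.2 := by exact_mod_cast htc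
  obtain ⟨ha, hb, y, hay, hby, hlt⟩ := id hab
  obtain ⟨-, hc, y', hby', hcy', hlt'⟩ := id hbc
  have hat : D.Reaches a (D.row b.2) := ⟨hay.1.trans hby.2, hta'⟩
  have hct : D.Reaches c (D.row b.2) := ⟨hcy'.1.trans hby'.2, htc'⟩
  have hbt : D.Reaches b (D.row b.2) := hb.reaches (.inr rfl)
  have h1 := hD.at_le_of_leftOf hab hat hbt
  have h2 := hD.at_le_of_leftOf hbc hbt hct
  rcases (h1.trans h2).lt_or_eq with h3 | h3
  · exact ⟨ha, hc, _, hat, hct, h3⟩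
  have e1 : D.abscissaAt a (D.row b.2) = D.abscissaAt b (D.row b.2) :=
    le_antisymm h1 (by rw [h3]; exact h2)
  have e2 : D.abscissaAt b (D.row b.2) = D.abscissaAt c (D.row b.2) := e1.symm.trans h3
  have hyt : y < D.row b.2 := lt_of_le_of_ne hby.2 (by rintro rfl; exact hlt.ne e1)
  have hyt' : y' < D.row b.2 := lt_of_le_of_ne hby'.2 (by rintro rfl; exact hlt'.ne e2)
  have hm : max y y' < D.row b.2 := max_lt hyt hyt'
  obtain ⟨α, β, hα⟩ := crossing_affine D.abscissa D.row a.1 a.2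
  obtain ⟨α', β', hα'⟩ := crossing_affine D.abscissa D.row b.1 b.2
  obtain ⟨α'', β'', hα''⟩ := crossing_affine D.abscissa D.row c.1 c.2
  refine ⟨ha, hc, max y y', ⟨hay.1.trans (le_max_left _ _), hm.le.trans hta'⟩,
    ⟨hcy'.1.trans (le_max_right _ _), hm.le.trans htc'⟩, ?_⟩
  simp only [abscissaAt, hα, hα', hα''] at hlt hlt' e1 e2 ⊢
  have hβ : β' < β := by nlinarith
  have hβ' : β'' < β' := by nlinarith
  nlinarith

end StraightLineDrawing

/-! ### From columns to a flat visibility representation -/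

namespace StraightLineDrawing

variable {V : Type*} {G : SimpleGraph V} (D : StraightLineDrawing G)

/-- Columns for the objects of `D` that respect the left-to-right order, and for each vertex the
leftmost and the rightmost column of an object which contains it. -/
structure Columns where
  column : V × V → ℤ
  first : V → ℤ
  last : V → ℤ
  column_lt : ∀ a b, D.LeftOf a b → column a < column b
  column_mem : ∀ v a, D.IsObject a → (v = a.1 ∨ v = a.2) →
    first v ≤ column a ∧ column a ≤ last v
  first_eq : ∀ v, ∃ a, D.IsObject a ∧ (v = a.1 ∨ v = a.2) ∧ column a = first v
  last_eq : ∀ v, ∃ a, D.IsObject a ∧ (v = a.1 ∨ v = a.2) ∧ column a = last v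

variable {D}

theorem IsPlanar.exists_columns [Finite V] (hD : D.IsPlanar) : Nonempty D.Columns := by
  obtain ⟨g, hg⟩ := exists_ranking D.LeftOf (fun a => D.row a.2)
    (fun a b h => hD.leftOf_asymm h) (fun a b c h h' => hD.leftOf_trans h h')
  have hne : ∀ v : V, {a | D.IsObject a ∧ (v = a.1 ∨ v = a.2)}.Nonempty :=
    fun v => ⟨(v, v), isObject_diag v, .inl rfl⟩
  choose a ha hamin using fun v => Set.exists_min_image _ g (Set.toFinite _) (hne v)
  choose b hb hbmax using fun v => Set.exists_max_image _ g (Set.toFinite _) (hne v)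
  exact ⟨⟨g, fun v => g (a v), fun v => g (b v), hg,
    fun v c hc hv => ⟨hamin v c ⟨hc, hv⟩, hbmax v c ⟨hc, hv⟩⟩,
    fun v => ⟨a v, (ha v).1, (ha v).2, rfl⟩, fun v => ⟨b v, (hb v).1, (hb v).2, rfl⟩⟩⟩

namespace Columns

variable (C : D.Columns)

theorem first_le_last (v : V) : C.first v ≤ C.last v :=
  have h := C.column_mem v (v, v) (isObject_diag v) (.inl rfl)
  h.1.trans h.2

/-- The first column of `w` belongs to an object passing through `w`, and `a` is to the left of that
object in the row of `w`. -/
theorem column_lt_first {a : V × V} (ha : D.IsObject a) {w : V} (hw : D.Reaches a (D.row w))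
    (h : D.abscissaAt a (D.row w) < D.abscissa w) : C.column a < C.first w := by
  obtain ⟨b, hb, hwb, e⟩ := C.first_eq w
  rw [← e]
  exact C.column_lt _ _ ⟨ha, hb, _, hw, hb.reaches hwb, by rwa [hb.at_row hwb]⟩

theorem last_lt_column {a : V × V} (ha : D.IsObject a) {w : V} (hw : D.Reaches a (D.row w))
    (h : D.abscissa w < D.abscissaAt a (D.row w)) : C.last w < C.column a := by
  obtain ⟨b, hb, hwb, e⟩ := C.last_eq w
  rw [← e]
  exact C.column_lt _ _ ⟨hb, ha, _, hb.reaches hwb, hw, by rwa [hb.at_row hwb]⟩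

theorem last_lt_first {u v : V} (hr : D.row u = D.row v) (h : D.abscissa u < D.abscissa v) :
    C.last u < C.first v := by
  obtain ⟨a, ha, hua, e⟩ := C.last_eq u
  rw [← e]
  refine C.column_lt_first ha ?_ ?_
  · rw [← hr]; exact ha.reaches hua
  · rw [← hr, ha.at_row hua]; exact h

/-- The point where the edge `uv` is attached to the segment of `u`. -/
noncomputable def attachAt (u v : V) : ℤ × ℤ :=
  (if D.row u < D.row v then C.column (u, v) else if D.row v < D.row u then C.column (v, u)
    else if (D.pos u).1 < (D.pos v).1 then C.last u else C.first u, D.row u)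

theorem attachAt_up {u v : V} (h : D.row u < D.row v) :
    C.attachAt u v = (C.column (u, v), D.row u) := by
  rw [attachAt, if_pos h]

theorem attachAt_down {u v : V} (h : D.row u < D.row v) :
    C.attachAt v u = (C.column (u, v), D.row v) := by
  rw [attachAt, if_neg h.not_gt, if_pos h]

theorem attachAt_right {u v : V} (h : D.row u = D.row v) (h' : (D.pos u).1 < (D.pos v).1) :
    C.attachAt u v = (C.last u, D.row u) := by
  rw [attachAt, if_neg h.not_lt, if_neg h.not_gt, if_pos h']

theorem attachAt_left {u v : V} (h : D.row u = D.row v) (h' : (D.pos u).1 < (D.pos v).1) :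
    C.attachAt v u = (C.first v, D.row v) := by
  rw [attachAt, if_neg h.not_gt, if_neg h.not_lt, if_neg h'.not_gt]

theorem mem_slanted {u v : V} (h : D.row u < D.row v) (z : ℝ × ℝ) :
    z ∈ gridSegment (C.attachAt u v) (C.attachAt v u) ↔
      (D.row u : ℝ) ≤ z.2 ∧ z.2 ≤ D.row v ∧ z.1 = C.column (u, v) := by
  rw [C.attachAt_up h, C.attachAt_down h]
  exact mem_gridSegment_vertical (p := (C.column (u, v), D.row u))
    (q := (C.column (u, v), D.row v)) h rfl z

theorem abscissa_lt {u v : V} (h : (D.pos u).1 < (D.pos v).1) : D.abscissa u < D.abscissa v :=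
  Int.cast_lt.2 h

theorem mem_flat {u v : V} (h : D.row u = D.row v) (h' : (D.pos u).1 < (D.pos v).1) (z : ℝ × ℝ) :
    z ∈ gridSegment (C.attachAt u v) (C.attachAt v u) ↔
      z.2 = D.row u ∧ (C.last u : ℝ) ≤ z.1 ∧ z.1 ≤ C.first v := by
  rw [C.attachAt_right h h', C.attachAt_left h h']
  exact mem_gridSegment_horizontal (p := (C.last u, D.row u)) (q := (C.first v, D.row v)) h
    (C.last_lt_first h (abscissa_lt h')).le z

theorem _root_.GraphDrawing.StraightLineDrawing.IsPlanar.orient (hD : D.IsPlanar) {u v : V}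
    (h : G.Adj u v) : (D.row u < D.row v ∨ D.row v < D.row u) ∨
      (D.row u = D.row v ∧ (D.pos u).1 < (D.pos v).1) ∨
      (D.row v = D.row u ∧ (D.pos v).1 < (D.pos u).1) := by
  rcases lt_trichotomy (D.row u) (D.row v) with hr | hr | hr
  · exact .inl (.inl hr)
  · rcases lt_trichotomy (D.pos u).1 (D.pos v).1 with hx | hx | hx
    · exact .inr (.inl ⟨hr, hx⟩)
    · exact absurd (hD.pos_inj (Prod.ext hx hr)) h.ne
    · exact .inr (.inr ⟨hr.symm, hx⟩)
  · exact .inl (.inr hr)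

/-- The flat visibility representation with the same rows. -/
noncomputable def flatten (hD : D.IsPlanar) : FlatVisibilityRepresentation G where
  left := C.first
  right := C.last
  row := D.row
  attach := C.attachAt
  left_le_right := C.first_le_last
  axis_parallel u v h := by
    rcases hD.orient h with (hr | hr) | ⟨hr, hx⟩ | ⟨hr, hx⟩
    · left; rw [C.attachAt_up hr, C.attachAt_down hr]
    · left; rw [C.attachAt_up hr, C.attachAt_down hr]
    · exact .inr hr
    · exact .inr hr.symm
  attached u v h := by
    ext z
    rw [Set.mem_inter_iff, Set.mem_singleton_iff, mem_flatBox]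
    rcases hD.orient h with (hr | hr) | ⟨hr, hx⟩ | ⟨hr, hx⟩
    · obtain ⟨h1, h2⟩ := C.column_mem u (u, v) (.inr ⟨h, hr⟩) (.inl rfl)
      rw [C.mem_slanted hr, C.attachAt_up hr, toPlane, Prod.ext_iff]
      refine ⟨fun hz => ⟨hz.1.2.2, hz.2.1⟩, fun ⟨e1, e2⟩ => ?_⟩
      dsimp only at e1 e2
      rw [e1, e2]
      exact ⟨⟨le_rfl, Int.cast_le.2 hr.le, rfl⟩, rfl, Int.cast_le.2 h1, Int.cast_le.2 h2⟩
    · obtain ⟨h1, h2⟩ := C.column_mem u (v, u) (.inr ⟨h.symm, hr⟩) (.inr rfl)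
      rw [gridSegment_comm, C.mem_slanted hr, C.attachAt_down hr, toPlane, Prod.ext_iff]
      refine ⟨fun hz => ⟨hz.1.2.2, hz.2.1⟩, fun ⟨e1, e2⟩ => ?_⟩
      dsimp only at e1 e2
      rw [e1, e2]
      exact ⟨⟨Int.cast_le.2 hr.le, le_rfl, rfl⟩, rfl, Int.cast_le.2 h1, Int.cast_le.2 h2⟩
    · rw [C.mem_flat hr hx, C.attachAt_right hr hx, toPlane, Prod.ext_iff]
      refine ⟨fun hz => ⟨le_antisymm hz.2.2.2 hz.1.2.1, hz.2.1⟩, fun ⟨e1, e2⟩ => ?_⟩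
      dsimp only at e1 e2
      rw [e1, e2]
      exact ⟨⟨rfl, le_rfl, Int.cast_le.2 (C.last_lt_first hr (abscissa_lt hx)).le⟩, rfl,
        Int.cast_le.2 (C.first_le_last u), le_rfl⟩
    · rw [gridSegment_comm, C.mem_flat hr hx, C.attachAt_left hr hx, toPlane, Prod.ext_iff]
      refine ⟨fun hz => ⟨le_antisymm hz.1.2.2 hz.2.2.1, hz.2.1⟩, fun ⟨e1, e2⟩ => ?_⟩
      dsimp only at e1 e2
      rw [e1, e2]
      exact ⟨⟨by rw [hr], Int.cast_le.2 (C.last_lt_first hr (abscissa_lt hx)).le, le_rfl⟩, rfl,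
        le_rfl, Int.cast_le.2 (C.first_le_last u)⟩

/-- An intersection in the new picture contradicts the column order unless the originals meet at the
same height. Planarity of `D` then supplies a common vertex, whose segment contains the column in
question. -/
theorem isPlanar_flatten (hD : D.IsPlanar) : (C.flatten hD).IsPlanar := by
  have inj : ∀ u v, D.row u = D.row v → (D.pos u).1 = (D.pos v).1 → u = v :=
    fun u v hr hx => hD.pos_inj (Prod.ext hx hr)
  have gap : ∀ u v w, G.Adj u v → D.row u = D.row v → D.row w = D.row u →
      (D.pos u).1 < (D.pos w).1 → (D.pos w).1 < (D.pos v).1 → False := by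
    intro u v w h hr hw h1 h2
    refine Set.disjoint_left.1 (hD.edge_vertex u v w h (by rintro rfl; exact h1.false)
      (by rintro rfl; exact h2.false)) ?_ (Set.mem_singleton (toPlane (D.pos w)))
    rw [mem_gridSegment_horizontal hr (h1.trans h2).le]
    exact ⟨congrArg Int.cast hw, Int.cast_le.2 h1.le, Int.cast_le.2 h2.le⟩
  have obj : ∀ {u v}, G.Adj u v → D.row u < D.row v → D.IsObject (u, v) :=
    fun h hr => .inr ⟨h, hr⟩
  refine IsPlanarPicture.of_oriented (fun u v => D.row u < D.row v)
    (fun u v => D.row u = D.row v ∧ (D.pos u).1 < (D.pos v).1)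
    (fun _ _ => gridSegment_comm _ _) (fun u v h => hD.orient h) ?_ ?_ ?_ ?_ ?_ ?_
  · intro u v hne
    rw [Set.disjoint_left]
    intro p hp hp'
    obtain ⟨h1, h2, h3⟩ := mem_flatBox.1 hp
    obtain ⟨h4, h5, h6⟩ := mem_flatBox.1 hp'
    have hr : D.row u = D.row v := by exact_mod_cast h1.symm.trans h4
    have h7 : C.first u ≤ C.last v := by exact_mod_cast h2.trans h6
    have h8 : C.first v ≤ C.last u := by exact_mod_cast h5.trans h3
    rcases lt_trichotomy (D.pos u).1 (D.pos v).1 with hx | hx | hx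
    · exact (C.last_lt_first hr (abscissa_lt hx)).not_ge h8
    · exact hne (inj u v hr hx)
    · exact (C.last_lt_first hr.symm (abscissa_lt hx)).not_ge h7
  · intro u v w h hr p hp hw
    obtain ⟨h1, h2, h3⟩ := (C.mem_slanted hr p).1 hp
    obtain ⟨h4, h5, h6⟩ := mem_flatBox.1 hw
    have h4 : p.2 = D.row w := h4
    rw [h4] at h1 h2
    rw [h3] at h5 h6
    have h5 : C.first w ≤ C.column (u, v) := by exact_mod_cast h5
    have h6 : C.column (u, v) ≤ C.last w := by exact_mod_cast h6
    have hreach : D.Reaches (u, v) (D.row w) := ⟨h1, h2⟩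
    rcases lt_trichotomy (D.abscissaAt (u, v) (D.row w)) (D.abscissa w) with hx | hx | hx
    · exact absurd h5 (C.column_lt_first (obj h hr) hreach hx).not_ge
    · obtain ⟨z, z1, z2, -⟩ := hD.meet (obj h hr) (isObject_diag w)
        (by rw [Ne, Prod.mk_inj]; rintro ⟨rfl, rfl⟩; exact hr.false) hreach
        ((isObject_diag w).reaches (.inl rfl))
        (hx.trans ((isObject_diag w).at_row (.inl rfl)).symm)
      have : z = w := z2.elim id id
      rw [← this]
      exact Sym2.mem_iff.2 z1
    · exact absurd h6 (C.last_lt_column (obj h hr) hreach hx).not_ge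
  · rintro u v w h ⟨hr, hx⟩ p hp hw
    obtain ⟨h1, h2, h3⟩ := (C.mem_flat hr hx p).1 hp
    obtain ⟨h4, h5, h6⟩ := mem_flatBox.1 hw
    have hwr : D.row w = D.row u := by exact_mod_cast h4.symm.trans h1
    have h7 : C.last u ≤ C.last w := by exact_mod_cast h2.trans h6
    have h8 : C.first w ≤ C.first v := by exact_mod_cast h5.trans h3
    have := C.first_le_last u
    have := C.first_le_last v
    rcases lt_trichotomy (D.pos w).1 (D.pos u).1 with hx1 | hx1 | hx1
    · have := C.last_lt_first hwr (abscissa_lt hx1)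
      omega
    · rw [inj w u hwr hx1]; simp
    rcases lt_trichotomy (D.pos w).1 (D.pos v).1 with hx2 | hx2 | hx2
    · exact (gap u v w h hr hwr hx1 hx2).elim
    · rw [inj w v (hwr.trans hr) hx2]; simp
    · have := C.last_lt_first (hwr.trans hr).symm (abscissa_lt hx2)
      omega
  · intro u v u' v' h h' hr hr' hne p hp hp'
    obtain ⟨h1, h2, h3⟩ := (C.mem_slanted hr p).1 hp
    obtain ⟨h4, h5, h6⟩ := (C.mem_slanted hr' p).1 hp'
    have hcol : C.column (u, v) = C.column (u', v') := by exact_mod_cast h3.symm.trans h6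
    have hy : D.Reaches (u, v) p.2 := ⟨h1, h2⟩
    have hy' : D.Reaches (u', v') p.2 := ⟨h4, h5⟩
    rcases lt_trichotomy (D.abscissaAt (u, v) p.2) (D.abscissaAt (u', v') p.2) with hx | hx | hx
    · exact absurd hcol (C.column_lt _ _ ⟨obj h hr, obj h' hr', _, hy, hy', hx⟩).ne
    · obtain ⟨z, z1, z2, z3⟩ := hD.meet (obj h hr) (obj h' hr')
        (by rintro e; exact hne (congrArg (fun a : V × V => s(a.1, a.2)) e)) hy hy' hx
      obtain ⟨c1, c2⟩ := C.column_mem z _ (obj h hr) z1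
      refine ⟨z, Sym2.mem_iff.2 z1, Sym2.mem_iff.2 z2, mem_flatBox.2 ⟨z3, ?_⟩⟩
      rw [h3]
      exact ⟨Int.cast_le.2 c1, Int.cast_le.2 c2⟩
    · exact absurd hcol (C.column_lt _ _ ⟨obj h' hr', obj h hr, _, hy', hy, hx⟩).ne'
  · rintro u v u' v' h h' hr ⟨hr', hx'⟩ p hp hp'
    obtain ⟨h1, h2, h3⟩ := (C.mem_slanted hr p).1 hp
    obtain ⟨h4, h5, h6⟩ := (C.mem_flat hr' hx' p).1 hp'
    rw [h4] at h1 h2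
    rw [h3, Int.cast_le] at h5 h6
    have hreach : D.Reaches (u, v) (D.row u') := ⟨h1, h2⟩
    have hreach' : D.Reaches (u, v) (D.row v') := by rw [← hr']; exact hreach
    have := C.first_le_last u'
    have := C.first_le_last v'
    have common : ∀ z, D.row u' = D.row z → D.abscissaAt (u, v) (D.row z) = D.abscissa z →
        z ∈ s(u', v') → ∃ w, w ∈ s(u, v) ∧ w ∈ s(u', v') ∧
          p ∈ flatBox (C.first w) (C.last w) (D.row w) := by
      intro z hz hat hzs
      have hreach : D.Reaches (u, v) (D.row z) := by rw [← hz]; exact hreach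
      obtain ⟨w, z1, z2, -⟩ := hD.meet (obj h hr) (isObject_diag z)
        (by rw [Ne, Prod.mk_inj]; rintro ⟨rfl, rfl⟩; exact hr.false) hreach
        ((isObject_diag z).reaches (.inl rfl))
        (hat.trans ((isObject_diag z).at_row (.inl rfl)).symm)
      obtain rfl : w = z := z2.elim id id
      obtain ⟨c1, c2⟩ := C.column_mem w _ (obj h hr) z1
      refine ⟨w, Sym2.mem_iff.2 z1, hzs, mem_flatBox.2 ⟨by rw [h4, hz], ?_⟩⟩
      rw [h3]
      exact ⟨Int.cast_le.2 c1, Int.cast_le.2 c2⟩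
    rcases lt_trichotomy (D.abscissaAt (u, v) (D.row u')) (D.abscissa u') with hx | hx | hx
    · have := C.column_lt_first (obj h hr) hreach hx
      omega
    · exact common u' rfl hx (by simp)
    rcases lt_trichotomy (D.abscissaAt (u, v) (D.row v')) (D.abscissa v') with hx2 | hx2 | hx2
    -- Here the slanted edge would cross the flat edge of `D` strictly between its two ends.
    · rw [← hr'] at hx2
      have hq : (D.abscissaAt (u, v) (D.row u'), (D.row u' : ℝ)) ∈
          gridSegment (D.pos u') (D.pos v') :=
        (mem_gridSegment_horizontal hr' hx'.le _).2 ⟨rfl, hx.le, hx2.le⟩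
      obtain ⟨w, -, hw, hq'⟩ := hD.edge_edge u v u' v' h h'
        (by intro e; rcases Sym2.eq_iff.1 e with ⟨rfl, rfl⟩ | ⟨rfl, rfl⟩ <;> omega) _
        ⟨(obj h hr).mem_gridSegment hreach, hq⟩
      have e : D.abscissaAt (u, v) (D.row u') = D.abscissa w := congrArg Prod.fst hq'
      rcases Sym2.mem_iff.1 hw with rfl | rfl
      · exact absurd e hx.ne'
      · exact absurd e hx2.ne
    · exact common v' hr' hx2 (by simp)
    · have := C.last_lt_column (obj h hr) hreach' hx2
      omega
  · rintro u v u' v' h h' ⟨hr, hx⟩ ⟨hr', hx'⟩ hne p hp hp'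
    obtain ⟨h1, h2, h3⟩ := (C.mem_flat hr hx p).1 hp
    obtain ⟨h4, h5, h6⟩ := (C.mem_flat hr' hx' p).1 hp'
    have hrr : D.row u = D.row u' := by exact_mod_cast h1.symm.trans h4
    -- Consecutive flat edges can touch only at a shared vertex whose segment is a single point;
    -- distinct vertices have separate column ranges.
    have key : ∀ {a b}, D.row a = D.row b → (D.pos a).1 ≤ (D.pos b).1 → p.1 ≤ C.first a →
        C.last b ≤ p.1 → p.2 = D.row a → a = b ∧ p ∈ flatBox (C.first a) (C.last a) (D.row a) := by
      intro a b hab hle ha hb hp2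
      have hab' : C.last b ≤ C.first a := by exact_mod_cast hb.trans ha
      have f1 := C.first_le_last a
      have f2 := C.first_le_last b
      rcases hle.eq_or_lt with e | e
      · obtain rfl := inj a b hab e
        have f1' : (C.first a : ℝ) ≤ C.last a := Int.cast_le.2 f1
        exact ⟨rfl, mem_flatBox.2 ⟨hp2, f1'.trans hb, ha.trans f1'⟩⟩
      · have := C.last_lt_first hab (abscissa_lt e)
        omega
    rcases flat_edges_apart inj gap h h' hr hr' hrr hx hx' hne with h7 | h7
    · obtain ⟨rfl, hpv⟩ := key (hr.symm.trans hrr) h7 h3 h5 (by rw [h1, hr])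
      exact ⟨v, by simp, by simp, hpv⟩
    · obtain ⟨rfl, hpv⟩ := key (hr'.symm.trans hrr.symm) h7 h6 h2 (by rw [h4, hr'])
      exact ⟨v', by simp, by simp, hpv⟩

end Columns

theorem IsPlanar.exists_flatVisibilityRepresentation [Finite V] (hD : D.IsPlanar) :
    ∃ D' : FlatVisibilityRepresentation G, D'.IsPlanar ∧ ∀ v, D'.row v = (D.pos v).2 := by
  obtain ⟨C⟩ := hD.exists_columns
  exact ⟨C.flatten hD, C.isPlanar_flatten hD, fun _ => rfl⟩

end StraightLineDrawing

end GraphDrawing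

/-! ### The equivalence, for both readings of height -/

theorem mainTheorem2 {V : Type*} [Finite V] (G : SimpleGraph V) (h : ℕ) :
    ((∃ D : GraphDrawing.StraightLineDrawing G,
        D.IsPlanar ∧ GraphDrawing.FitsHeight D.points h) ↔
      (∃ D : GraphDrawing.FlatVisibilityRepresentation G,
        D.IsPlanar ∧ GraphDrawing.FitsHeight D.points h)) ∧
    ((∃ D : GraphDrawing.StraightLineDrawing G,
        D.IsPlanar ∧ GraphDrawing.IsExactHeight D.points h) ↔
      (∃ D : GraphDrawing.FlatVisibilityRepresentation G,
        D.IsPlanar ∧ GraphDrawing.IsExactHeight D.points h)) := by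
  refine ⟨⟨?_, ?_⟩, ⟨?_, ?_⟩⟩
  · rintro ⟨D, hD, hh⟩
    obtain ⟨D', hD', hr⟩ := hD.exists_flatVisibilityRepresentation
    exact ⟨D', hD', (GraphDrawing.fitsHeight_congr D.points_finite D'.points_finite
      (GraphDrawing.snd_image_points_eq hr) h).1 hh⟩
  · rintro ⟨D', hD', hh⟩
    obtain ⟨D, hD, hr⟩ := hD'.exists_straightLineDrawing
    exact ⟨D, hD, (GraphDrawing.fitsHeight_congr D.points_finite D'.points_finite
      (GraphDrawing.snd_image_points_eq hr) h).2 hh⟩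
  · rintro ⟨D, hD, hh⟩
    obtain ⟨D', hD', hr⟩ := hD.exists_flatVisibilityRepresentation
    exact ⟨D', hD', (GraphDrawing.isExactHeight_congr D.points_finite D'.points_finite
      (GraphDrawing.snd_image_points_eq hr) h).1 hh⟩
  · rintro ⟨D', hD', hh⟩
    obtain ⟨D, hD, hr⟩ := hD'.exists_straightLineDrawing
    exact ⟨D, hD, (GraphDrawing.isExactHeight_congr D.points_finite D'.points_finite
      (GraphDrawing.snd_image_points_eq hr) h).2 hh⟩
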